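/- Let $p$ be a prime, $g_0\ge 0$ and $t\ge 1$ integers, and let $F_0$ be a (Fuchsian) group with presentation $$\langle a_1,\dots,a_{g_0},b_1,\dots,b_{g_0},x_1,\dots,x_t \mid x_1\cdots x_t\prod_{i=1}^{g_0}[a_i,b_i]=1,\ x_j^p=1\ (1\le j\le t)\rangle .$$ Let $\phi:F_0\to\mathbb Z_p$ be a homomorphism with $\phi(a_i)=\phi(b_i)=0$ for all $i$ and $\phi(x_j)\neq 0$ for all $j$, let $F=\ker\phi$, and let $h$ be the automorphism of $F$ given by conjugation by $x_1$, $h(w)=x_1wx_1^{-1}$. For $w\in F_0$ let $\overline w$ denote the power of $x_1$ with $\phi(\overline w)=\phi(w)$. Put $A_i=a_i$, $B_i=b_i$ for $1\le i\le g_0$, and, for arbitrarily chosen integers $k_3,\dots,k_t\ge 0$ (for instance all $k_i=0$, in which case $X_i=x_i\,\overline{x_i}^{\,-1}$), put $$X_i=K_ix_i\,\overline{K_ix_i}^{\,-1},\qquad K_i=x_1^{k_i},\qquad 3\le i\le t .$$ Then there is a single word $\hat{\hat R}$ in symbols standing for the elements $h^j(A_i)$, $h^j(B_i)$ ($1\le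 i\le g_0$, $0\le j\le p-1$) and $h^j(X_i)$ ($3\le i\le t$, $0\le j\le p-2$) of $F$, and in their inverses, such that $F$ has the presentation $$F=\langle h^j(A_i),h^j(B_i)\ (1\le i\le g_0,\ 0\le j\le p-1),\ h^j(X_i)\ (3\le i\le t,\ 0\le j\le p-2)\mid \hat{\hat R}=1\rangle ,$$ and such that: 1. each generator and its inverse occur exactly once in $\hat{\hat R}$; in particular $\hat{\hat R}$ is evenly worded, that is, a generator occurs in it if and only if its inverse does; 2. every generator is linked to another, distinct generator in the relation $\hat{\hat R}=1$. Here two generators $A,B$ are linked in a word if, for one of the two orders of the pair, the word has the form $W_0AW_1BW_2A^{-1}W_3B^{-1}W_4$ with words $W_0,\dots,W_4$ not involving $A^{\pm1}$ or $B^{\pm1}$, and they are linked in a relation $R=1$ if they are linked in some cyclic permutation of the word $R$. If moreover $K_i=\overline{x_1x_2\cdots x_{i-1}}$ for all $3\le i\le t$, then every generator is linked to another, distinct generator in the word $\hat{\hat R}$ itself, without a cyclic permutation. -/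

import Mathlib

/-- The subgroup `H` of `G` has the presentation `⟨ α | rels ⟩`, the generating symbol `s : α`
standing for the element `f s`: these elements generate `H`, and the relations among them are
exactly the consequences of `rels`. -/
def Subgroup.HasPresentation {G : Type*} [Group G] (H : Subgroup G) {α : Type*} (f : α → G)
    (rels : Set (FreeGroup α)) : Prop :=
  (FreeGroup.lift f).range = H ∧ (FreeGroup.lift f).ker = Subgroup.normalClosure rels

/-- Generating symbols `a_1, …, a_g, b_1, …, b_g, x_1, …, x_t` (indexed from `0`). -/
inductive OrbifoldGen (g t : ℕ) : Type
  | a (i : Fin g) : OrbifoldGen g t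
  | b (i : Fin g) : OrbifoldGen g t
  | x (j : Fin t) : OrbifoldGen g t

/-- The relators `x_1 ⋯ x_t [a_1,b_1] ⋯ [a_g,b_g]` and `x_j ^ p`. -/
def orbifoldRels (g t p : ℕ) : Set (FreeGroup (OrbifoldGen g t)) :=
  {(List.ofFn fun j : Fin t => FreeGroup.of (OrbifoldGen.x j)).prod *
    (List.ofFn fun i : Fin g =>
      FreeGroup.of (OrbifoldGen.a (t := t) i) * FreeGroup.of (OrbifoldGen.b (t := t) i) *
        (FreeGroup.of (OrbifoldGen.a (t := t) i))⁻¹ *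
        (FreeGroup.of (OrbifoldGen.b (t := t) i))⁻¹).prod} ∪
  Set.range fun j : Fin t => FreeGroup.of (OrbifoldGen.x (g := g) j) ^ p

/-- The Schreier representative of the coset of `w` modulo `ker φ`, among the powers of `y`:
the power `y ^ q` with `φ (y ^ q) = φ w` (for `p` prime and `φ y ≠ 0`). -/
def schreierRep {G : Type*} [Group G] {p : ℕ} (φ : G →* Multiplicative (ZMod p)) (y w : G) : G :=
  y ^ (Multiplicative.toAdd (φ w) * (Multiplicative.toAdd (φ y))⁻¹).val

/-- Schreier's element `S_{K,y} = K y (rep (K y))⁻¹`, for coset representatives that are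
powers of `x₁`. -/
def schreierElt {G : Type*} [Group G] {p : ℕ} (φ : G →* Multiplicative (ZMod p)) (x₁ K y : G) : G :=
  K * y * (schreierRep φ x₁ (K * y))⁻¹

/-- Generating symbols `h^j(A_i)`, `h^j(B_i)` for `0 ≤ j ≤ p - 1`, and `h^j(X_i)` for
`0 ≤ j ≤ p - 2`, where `X_1` and `X_2` are omitted (that is, the indices `0` and `1` of `Fin t`). -/
inductive KernelGen (g t p : ℕ) : Type
  | A (i : Fin g) (j : Fin p) : KernelGen g t p
  | B (i : Fin g) (j : Fin p) : KernelGen g t p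
  | X (i : Fin t) (hi : 2 ≤ i.val) (j : Fin (p - 1)) : KernelGen g t p

/-- The elements for which the symbols stand: `h` is conjugation by `x_1`, and
`A_i = a_i`, `B_i = b_i`, `X_i = S_{K,x_i}` with `K = x_1 ^ k_i`. -/
def kernelElt {g t p : ℕ} {G : Type*} [Group G] (ht : 0 < t) (y : OrbifoldGen g t → G)
    (φ : G →* Multiplicative (ZMod p)) (k : Fin t → ℕ) : KernelGen g t p → G
  | .A i j => (MulAut.conj (y (.x ⟨0, ht⟩)) ^ j.val) (y (.a i))
  | .B i j => (MulAut.conj (y (.x ⟨0, ht⟩)) ^ j.val) (y (.b i))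
  | .X i _ j => (MulAut.conj (y (.x ⟨0, ht⟩)) ^ j.val)
      (schreierElt φ (y (.x ⟨0, ht⟩)) (y (.x ⟨0, ht⟩) ^ k i) (y (.x i)))

/-! Words in the symbols of `α` and their inverses are lists over `α × Bool`, as for `FreeGroup`:
`(s, true)` is the letter `s` and `(s, false)` the letter `s⁻¹`. -/

/-- A word whose letters are not `s` or `s⁻¹`. -/
def NotInvolving {α : Type*} (s : α) (W : List (α × Bool)) : Prop :=
  (s, true) ∉ W ∧ (s, false) ∉ W

/-- For each generator that occurs, to the power `1` or `-1`, its inverse occurs too. -/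
def EvenlyWorded {α : Type*} (R : List (α × Bool)) : Prop :=
  ∀ s : α, (s, true) ∈ R ↔ (s, false) ∈ R

/-- The letter `s` and its inverse occur exactly once each. -/
def OccursOnceEach {α : Type*} (s : α) (R : List (α × Bool)) : Prop :=
  (∃ U V, R = U ++ (s, true) :: V ∧ (s, true) ∉ U ∧ (s, true) ∉ V) ∧
  (∃ U V, R = U ++ (s, false) :: V ∧ (s, false) ∉ U ∧ (s, false) ∉ V)

/-- The word `R` is `W₀ s W₁ u W₂ s⁻¹ W₃ u⁻¹ W₄`, where the `W_i` do not involve `s` or `u`. -/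
def LinkedForm {α : Type*} (R : List (α × Bool)) (s u : α) : Prop :=
  ∃ W₀ W₁ W₂ W₃ W₄ : List (α × Bool),
    (∀ W ∈ [W₀, W₁, W₂, W₃, W₄], NotInvolving s W ∧ NotInvolving u W) ∧
    R = W₀ ++ [(s, true)] ++ W₁ ++ [(u, true)] ++ W₂ ++ [(s, false)] ++ W₃ ++ [(u, false)] ++ W₄

/-- The (unordered) pair of generators `s`, `u` is linked in the word `R`. -/
def LinkedInWord {α : Type*} (R : List (α × Bool)) (s u : α) : Prop :=
  LinkedForm R s u ∨ LinkedForm R u s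

/-- The pair of generators `s`, `u` is linked in the relation `R = 1`, which may be written
with any cyclic permutation of the word `R`. -/
def LinkedInRelation {α : Type*} (R : List (α × Bool)) (s u : α) : Prop :=
  ∃ R' : List (α × Bool), R' ~r R ∧ LinkedInWord R' s u

/-!
The kernel is generated by the Schreier elements `S_l(n) = x_1 ^ n x_l x_1 ^ (-(n + e_l))` for the
transversal of the powers of `x_1`, where `e_l = φ x_l / φ x_1`, and by the conjugates of `a_i` and
`b_i` by the powers of `x_1`.

*The relator.* The long relation expresses `x_2` by the other generators, and `x_2 ^ p = 1` becomes
`(x_3 ⋯ x_t [a_1, b_1] ⋯ [a_g, b_g] x_1) ^ p = 1`. Written in Schreier elements, this is a word of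
`p` blocks, in which each `S_i(n)`, `i ≥ 3`, and each conjugate of a commutator occurs once. The
relation `x_i ^ p = 1` becomes `S_i(n) S_i(n + e_i) ⋯ S_i(n + (p - 1) e_i) = 1`. It eliminates
`S_i(k_i - 1)`, the one member of the family that is not a generator, so one of the letters is
replaced by the product of the inverses of the others, and each remaining generator and its inverse
occur once. This word is `relatorWord`.

*The presentation.* That the relator holds and that the symbols generate the kernel is computed in
the group (`IsSchreierSystem.wordVal_relatorWord`, `IsSchreierSystem.mem_range_of_hom_eq_one`). That
there are no further relations is seen from an action. Let `Γ` be the group presented by the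
relator, and let `φ` be scaled so that `φ x_1 = 1`. The formula
`x (n, γ) = (n - φ x, S_x(n - φ x) γ)`, with the Schreier elements taken in `Γ`, defines an action of
the orbifold group on `ZMod p × Γ` (`lift_orbifoldPerm_eq_one`). An element of the kernel that is
given by a word `w` sends `(0, 1)` to `(0, w)` (`hom_lift_apply`), so that `w = 1` in `Γ` if the
element is trivial.

*Linking.* The letters of the relator are ordered by `letterKey`, so a pair is seen to be linked by
comparison of four keys: up to cyclic permutation, the two chords that join each generator to its
inverse have to cross (`LinkedInRelation.of_separated`). The generators `h^j(A_i)` and `h^j(B_i)`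
are linked in their commutator. The generators `S_i(n)` with the same `i` form a family, whose
inverses all stand at a single place. If there are two families, each generator of one is linked to
a generator of the other (`exists_linkedInRelation_of_ne`). If there is only one, then
`1 + e_2 + e_3 = 0`, so that `e_3 ≠ -e_2`, and a count of residues yields two members of the family with crossing chords
(`exists_linked_same_family`). If `X_i` starts at the coset of `x_1 ⋯ x_{i-1}`, the inverses of all
families lie in the last block, and no cyclic permutation is needed.
-/

/-! ### Linked pairs in words with pairwise distinct letters -/

section Linking

variable {α : Type*} {R : List (α × Bool)} {s u : α}

theorem LinkedForm.of_sublist (hR : R.Nodup)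
    (h : [(s, true), (u, true), (s, false), (u, false)].Sublist R) : LinkedForm R s u := by
  have hsu : s ≠ u := by
    have := h.nodup hR
    rintro rfl
    simp at this
  obtain ⟨r₁, r₁', rfl, m₁, h₁⟩ := List.cons_sublist_iff.1 h
  obtain ⟨r₂, r₂', rfl, m₂, h₂⟩ := List.cons_sublist_iff.1 h₁
  obtain ⟨r₃, r₃', rfl, m₃, h₃⟩ := List.cons_sublist_iff.1 h₂
  have m₄ : (u, false) ∈ r₃' := List.singleton_sublist.1 h₃
  obtain ⟨a₁, b₁, rfl⟩ := List.append_of_mem m₁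
  obtain ⟨a₂, b₂, rfl⟩ := List.append_of_mem m₂
  obtain ⟨a₃, b₃, rfl⟩ := List.append_of_mem m₃
  obtain ⟨a₄, b₄, rfl⟩ := List.append_of_mem m₄
  refine ⟨a₁, b₁ ++ a₂, b₂ ++ a₃, b₃ ++ a₄, b₄, ?_, by simp⟩
  simp only [List.nodup_append, List.nodup_cons, List.mem_append, List.mem_cons] at hR
  intro W hW
  simp only [List.mem_cons, List.not_mem_nil, or_false] at hW
  clear m₁ m₂ m₃ m₄ h h₁ h₂ h₃
  simp only [NotInvolving]
  rcases hW with rfl | rfl | rfl | rfl | rfl <;> grind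

/-- A cyclic permutation takes the first letter of a subword to its end. -/
theorem exists_isRotated_sublist {β : Type*} {R : List β} {a : β} {l : List β}
    (h : (a :: l).Sublist R) : ∃ R', R' ~r R ∧ (l ++ [a]).Sublist R' := by
  obtain ⟨r₁, r₂, rfl, m, h⟩ := List.cons_sublist_iff.1 h
  exact ⟨r₂ ++ r₁, List.isRotated_append, h.append (List.singleton_sublist.2 m)⟩

theorem LinkedInRelation.symm (h : LinkedInRelation R s u) : LinkedInRelation R u s := by
  obtain ⟨R', h, h'⟩ := h
  exact ⟨R', h, h'.symm⟩

theorem LinkedInRelation.of_isRotated {R' : List (α × Bool)} (h' : R' ~r R)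
    (h : LinkedInRelation R' s u) : LinkedInRelation R s u := by
  obtain ⟨R'', h₁, h₂⟩ := h
  exact ⟨R'', h₁.trans h', h₂⟩

theorem LinkedInRelation.of_sublist (hR : R.Nodup)
    (h : [(s, true), (u, true), (s, false), (u, false)].Sublist R) : LinkedInRelation R s u :=
  ⟨R, List.IsRotated.refl _, Or.inl (.of_sublist hR h)⟩

theorem LinkedInRelation.of_sublist₁ (hR : R.Nodup)
    (h : [(u, false), (s, true), (u, true), (s, false)].Sublist R) : LinkedInRelation R s u := by
  obtain ⟨R', h₁, h₂⟩ := exists_isRotated_sublist h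
  exact (LinkedInRelation.of_sublist (h₁.perm.nodup_iff.2 hR) h₂).of_isRotated h₁

theorem LinkedInRelation.of_sublist₂ (hR : R.Nodup)
    (h : [(s, false), (u, false), (s, true), (u, true)].Sublist R) : LinkedInRelation R s u := by
  obtain ⟨R', h₁, h₂⟩ := exists_isRotated_sublist h
  exact (LinkedInRelation.of_sublist₁ (h₁.perm.nodup_iff.2 hR) h₂).of_isRotated h₁

theorem LinkedInRelation.of_sublist₃ (hR : R.Nodup)
    (h : [(u, true), (s, false), (u, false), (s, true)].Sublist R) : LinkedInRelation R s u := by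
  obtain ⟨R', h₁, h₂⟩ := exists_isRotated_sublist h
  exact (LinkedInRelation.of_sublist₂ (h₁.perm.nodup_iff.2 hR) h₂).of_isRotated h₁

variable {κ : Type*} [LinearOrder κ] {key : α × Bool → κ}

theorem sublist_of_pairwise_key {β : Type*} {key : β → κ} {R l : List β}
    (hR : R.Pairwise (key · < key ·)) (hl : l.Pairwise (key · < key ·)) (h : l ⊆ R) :
    l.Sublist R := by
  have : Std.Antisymm fun a b : β => key a < key b := ⟨fun a b h h' => (lt_asymm h h').elim⟩
  exact List.sublist_of_subperm_of_pairwise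
    (List.subperm_of_subset (hl.imp fun h e => by simp [e] at h) h) hl hR

theorem LinkedForm.of_key_lt (hR : R.Pairwise (key · < key ·)) (hmem : ∀ x, x ∈ R)
    (h₁ : key (s, true) < key (u, true)) (h₂ : key (u, true) < key (s, false))
    (h₃ : key (s, false) < key (u, false)) : LinkedForm R s u := by
  refine .of_sublist (hR.imp fun h e => by simp [e] at h)
    (sublist_of_pairwise_key hR ?_ fun x _ => hmem x)
  simp only [List.pairwise_cons, List.mem_cons]
  grind

/-- In a word whose letters are ordered by `key`, two generators are linked up to cyclic
permutation if the chord joining `s` to `s⁻¹` separates `u` from `u⁻¹`. -/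
theorem LinkedInRelation.of_separated (hR : R.Pairwise (key · < key ·)) (hmem : ∀ x, x ∈ R)
    (hsu : u ≠ s)
    (h : ¬ ((key (s, true) < key (u, true) ↔ key (s, false) < key (u, true)) ↔
      (key (s, true) < key (u, false) ↔ key (s, false) < key (u, false)))) :
    LinkedInRelation R s u := by
  have hnd : R.Nodup := hR.imp fun h e => by simp [e] at h
  have inj : ∀ x y, key x = key y → x = y := by
    refine fun x y => List.inj_on_of_nodup_map (l := R) ?_ (hmem x) (hmem y)
    exact List.pairwise_map.2 (hR.imp fun h => h.ne)
  have sub : ∀ a b c d, key a < key b → key b < key c → key c < key d → [a, b, c, d].Sublist R := by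
    intro a b c d h₁ h₂ h₃
    refine sublist_of_pairwise_key hR ?_ fun x _ => hmem x
    simp only [List.pairwise_cons, List.mem_cons]
    grind
  have d₁ : key (s, true) ≠ key (s, false) := fun h => by simpa using inj _ _ h
  have d₂ : key (s, true) ≠ key (u, true) := fun h => hsu (by simpa using (inj _ _ h).symm)
  have d₃ : key (s, true) ≠ key (u, false) := fun h => by simpa using inj _ _ h
  have d₄ : key (s, false) ≠ key (u, true) := fun h => by simpa using inj _ _ h
  have d₅ : key (s, false) ≠ key (u, false) := fun h => hsu (by simpa using (inj _ _ h).symm)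
  have d₆ : key (u, true) ≠ key (u, false) := fun h => by simpa using inj _ _ h
  -- The eight cyclic orders in which the two chords cross.
  have c₀ := fun h₁ h₂ h₃ => LinkedInRelation.of_sublist hnd
    (sub (s, true) (u, true) (s, false) (u, false) h₁ h₂ h₃)
  have c₁ := fun h₁ h₂ h₃ => LinkedInRelation.of_sublist₁ hnd
    (sub (u, false) (s, true) (u, true) (s, false) h₁ h₂ h₃)
  have c₂ := fun h₁ h₂ h₃ => LinkedInRelation.of_sublist₂ hnd
    (sub (s, false) (u, false) (s, true) (u, true) h₁ h₂ h₃)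
  have c₃ := fun h₁ h₂ h₃ => LinkedInRelation.of_sublist₃ hnd
    (sub (u, true) (s, false) (u, false) (s, true) h₁ h₂ h₃)
  have c₄ := fun h₁ h₂ h₃ => (LinkedInRelation.of_sublist hnd
    (sub (u, true) (s, true) (u, false) (s, false) h₁ h₂ h₃)).symm
  have c₅ := fun h₁ h₂ h₃ => (LinkedInRelation.of_sublist₁ hnd
    (sub (s, false) (u, true) (s, true) (u, false) h₁ h₂ h₃)).symm
  have c₆ := fun h₁ h₂ h₃ => (LinkedInRelation.of_sublist₂ hnd
    (sub (u, false) (s, false) (u, true) (s, true) h₁ h₂ h₃)).symm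
  have c₇ := fun h₁ h₂ h₃ => (LinkedInRelation.of_sublist₃ hnd
    (sub (s, true) (u, false) (s, false) (u, true) h₁ h₂ h₃)).symm
  clear sub inj hR hmem hnd
  generalize key (s, true) = a at *
  generalize key (s, false) = b at *
  generalize key (u, true) = c at *
  generalize key (u, false) = d at *
  rcases lt_or_gt_of_ne d₁ with d₁ | d₁ <;> rcases lt_or_gt_of_ne d₂ with d₂ | d₂ <;>
    rcases lt_or_gt_of_ne d₃ with d₃ | d₃ <;> rcases lt_or_gt_of_ne d₄ with d₄ | d₄ <;>
    rcases lt_or_gt_of_ne d₅ with d₅ | d₅ <;> rcases lt_or_gt_of_ne d₆ with d₆ | d₆ <;>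
    simp only [d₁, d₂, d₃, d₄, d₅, d₆, d₂.not_gt, d₃.not_gt, d₄.not_gt, d₅.not_gt,
      not_true, iff_self, iff_true, iff_false, not_false_eq_true, true_implies] at * <;>
    assumption

theorem OccursOnceEach.of_nodup (hnd : R.Nodup) (hmem : ∀ x, x ∈ R) (s : α) :
    OccursOnceEach s R := by
  have aux : ∀ x, ∃ U V, R = U ++ x :: V ∧ x ∉ U ∧ x ∉ V := by
    intro x
    obtain ⟨U, V, h⟩ := List.append_of_mem (hmem x)
    rw [h, List.nodup_append, List.nodup_cons] at hnd
    exact ⟨U, V, h, fun hx => hnd.2.2 x hx x List.mem_cons_self rfl, hnd.2.1.1⟩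
  exact ⟨aux _, aux _⟩

end Linking

/-! ### Reversal of order by multiplication modulo a prime -/

/-- If multiplication by `c` reverses the order of `s` relative to every other nonzero residue,
then as many residues lie below `s` as above `c * s`, so `s` and `c * s` add up to `p`. -/
theorem ZMod.eq_neg_one_of_val_lt_iff {p : ℕ} [Fact p.Prime] {c s : ZMod p} (hc : c ≠ 0)
    (hs : s ≠ 0) (h : ∀ u : ZMod p, u ≠ 0 → u ≠ s → (u.val < s.val ↔ (c * s).val < (c * u).val)) :
    c = -1 := by
  have hcs : c * s ≠ 0 := mul_ne_zero hc hs
  have key : (Finset.Ioo 0 s.val).card = (Finset.Ioo (c * s).val p).card := by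
    refine Finset.card_bij (fun a _ => (c * (a : ZMod p)).val) ?_ ?_ ?_
    · intro a ha
      rw [Finset.mem_Ioo] at ha
      have hap := ha.2.trans (ZMod.val_lt s)
      have hv : (a : ZMod p).val = a := ZMod.val_cast_of_lt hap
      have h0 : (a : ZMod p) ≠ 0 := fun h0 => by simp [h0] at hv; omega
      rw [Finset.mem_Ioo]
      exact ⟨(h _ h0 (fun e => by rw [e] at hv; omega)).1 (by omega), ZMod.val_lt _⟩
    · intro a ha b hb hab
      rw [Finset.mem_Ioo] at ha hb
      have := mul_left_cancel₀ hc (ZMod.val_injective p hab)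
      have := congrArg ZMod.val this
      rwa [ZMod.val_cast_of_lt (ha.2.trans (ZMod.val_lt s)),
        ZMod.val_cast_of_lt (hb.2.trans (ZMod.val_lt s))] at this
    · intro b hb
      rw [Finset.mem_Ioo] at hb
      have hv : (b : ZMod p).val = b := ZMod.val_cast_of_lt hb.2
      have h0 : (b : ZMod p) ≠ 0 := fun h0 => by simp [h0] at hv; omega
      have hcc : c * (c⁻¹ * (b : ZMod p)) = b := mul_inv_cancel_left₀ hc _
      have h0' : c⁻¹ * (b : ZMod p) ≠ 0 := mul_ne_zero (inv_ne_zero hc) h0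
      refine ⟨(c⁻¹ * (b : ZMod p)).val, ?_, ?_⟩
      · rw [Finset.mem_Ioo]
        refine ⟨Nat.pos_of_ne_zero ((ZMod.val_ne_zero _).2 h0'), (h _ h0' ?_).2 ?_⟩
        · intro e
          rw [← e, hcc] at hb
          omega
        · rw [hcc, hv]; exact hb.1
      · rw [ZMod.natCast_zmod_val, hcc, hv]
  rw [Nat.card_Ioo, Nat.card_Ioo] at key
  have h1 := Nat.pos_of_ne_zero ((ZMod.val_ne_zero _).2 hs)
  have h2 := ZMod.val_lt (c * s)
  have h3 : s.val + (c * s).val = p := by omega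
  have h4 : s + c * s = 0 := by
    have := congrArg (Nat.cast : ℕ → ZMod p) h3
    simpa using this
  have h5 : (c + 1) * s = 0 := by rw [← h4]; ring
  exact eq_neg_of_add_eq_zero_left ((mul_eq_zero.1 h5).resolve_right hs)

/-! ### The relator of the kernel -/

section Relator

variable {g s p : ℕ}

/-- The number `r < p` with `-1 - (r + 1) * e = ν`, for a prime `p` and `e ≠ 0`: the position of
`ν` in the arithmetic progression of difference `-e` that ends with `-1`. -/
def progIndex (e ν : ZMod p) : ℕ := (-(ν + 1) * e⁻¹ - 1).val

variable [Fact p.Prime]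

theorem progIndex_lt (e ν : ZMod p) : progIndex e ν < p := ZMod.val_lt _

theorem progIndex_spec {e : ZMod p} (he : e ≠ 0) (ν : ZMod p) :
    -1 - ((progIndex e ν : ZMod p) + 1) * e = ν := by
  rw [progIndex, ZMod.natCast_zmod_val]
  field_simp
  ring

theorem progIndex_eq {e : ZMod p} (he : e ≠ 0) {r : ℕ} (hr : r < p) :
    progIndex e (-1 - ((r : ZMod p) + 1) * e) = r := by
  have : -(-1 - ((r : ZMod p) + 1) * e + 1) * e⁻¹ - 1 = r := by
    field_simp
    ring
  rw [progIndex, this, ZMod.val_cast_of_lt hr]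

theorem progIndex_injective {e : ZMod p} (he : e ≠ 0) : Function.Injective (progIndex e) := by
  intro ν ν' h
  rw [← progIndex_spec he ν, h, progIndex_spec he]

theorem ZMod.natCast_pred : ((p - 1 : ℕ) : ZMod p) = -1 := by
  rw [Nat.cast_sub (Fact.out : p.Prime).one_lt.le, ZMod.natCast_self, Nat.cast_one, zero_sub]

theorem ZMod.val_neg_one_eq_pred : (-1 : ZMod p).val = p - 1 := by
  rw [← ZMod.natCast_pred, ZMod.val_cast_of_lt]
  exact Nat.sub_lt (Fact.out : p.Prime).pos one_pos

theorem progIndex_neg_one (e : ZMod p) : progIndex e (-1) = p - 1 := by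
  rw [progIndex, neg_add_cancel, neg_zero, zero_mul, zero_sub, ZMod.val_neg_one_eq_pred]

theorem ZMod.val_lt_pred {d : ZMod p} (hd : d ≠ -1) : d.val < p - 1 := by
  have h1 := ZMod.val_lt d
  have h2 : d.val ≠ (-1 : ZMod p).val := fun h => hd (ZMod.val_injective p h)
  rw [ZMod.val_neg_one_eq_pred] at h2
  omega

/-- The symbol for the conjugate of `a_i` by `x_1 ^ n`. -/
def genA (i : Fin g) (n : ZMod p) : KernelGen g (s + 2) p := .A i ⟨n.val, ZMod.val_lt n⟩

/-- The symbol for the conjugate of `b_i` by `x_1 ^ n`. -/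
def genB (i : Fin g) (n : ZMod p) : KernelGen g (s + 2) p := .B i ⟨n.val, ZMod.val_lt n⟩

/-- The symbol for the conjugate by `x_1 ^ d` of the Schreier element with index `j + 2`, counted
from `0`. There is none for `d = -1`, where the value is of no significance. -/
def genX (j : Fin s) (d : ZMod p) : KernelGen g (s + 2) p :=
  .X j.succ.succ (by simp) ⟨d.val % (p - 1),
    Nat.mod_lt _ (Nat.sub_pos_of_lt (Fact.out : p.Prime).one_lt)⟩

/-- Every generator is one of the symbols indexed by residues. -/
theorem KernelGen.cases_zmod (c : KernelGen g (s + 2) p) :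
    (∃ i n, c = genA i n) ∨ (∃ i n, c = genB i n) ∨ ∃ j d, d ≠ -1 ∧ c = genX j d := by
  rcases c with ⟨i, n⟩ | ⟨i, n⟩ | ⟨i, hi, m⟩
  · exact Or.inl ⟨i, (n : ℕ), by simp [genA, ZMod.val_cast_of_lt n.2]⟩
  · exact Or.inr (Or.inl ⟨i, (n : ℕ), by simp [genB, ZMod.val_cast_of_lt n.2]⟩)
  · have hm : ((m : ℕ) : ZMod p).val = m := ZMod.val_cast_of_lt (by omega)
    refine Or.inr (Or.inr ⟨⟨i - 2, by omega⟩, (m : ℕ), fun h => ?_, ?_⟩)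
    · rw [h, ZMod.val_neg_one_eq_pred] at hm
      omega
    · simp only [genX, hm, Nat.mod_eq_of_lt m.2, Fin.eta]
      congr 1
      ext
      simp only [Fin.val_succ]
      omega

theorem genX_injective {j j' : Fin s} {d d' : ZMod p} (hd : d ≠ -1) (hd' : d' ≠ -1)
    (h : genX (g := g) j d = genX j' d') : j = j' ∧ d = d' := by
  simp only [genX, KernelGen.X.injEq, Fin.succ_inj, Fin.mk.injEq,
    Nat.mod_eq_of_lt (ZMod.val_lt_pred hd), Nat.mod_eq_of_lt (ZMod.val_lt_pred hd')] at h
  exact ⟨h.1, ZMod.val_injective p h.2⟩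

/-! In what follows, `e₁` and `ε j` are the images in `ZMod p` of `x_2` and of the generator with
index `j + 2`, counted from `0`, when `x_1` has the image `1`. The word `K_i x_i` starts at the
coset of `x_1 ⋯ x_{i-1}`, moved on by `τ j`. -/

variable (e₁ : ZMod p) (ε τ : Fin s → ZMod p)

/-- The word that stands for the conjugate by `x_1 ^ d` of the Schreier element with index
`j + 2`. It is a single letter unless `d = -1`; in this case the relation `x ^ p = 1` expresses the
missing element by the others of its family, which are passed through in steps of `ε j`, the
image of `x` in `ZMod p`. -/
def slotWord (j : Fin s) (d : ZMod p) : List (KernelGen g (s + 2) p × Bool) :=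
  if d = -1 then
    (List.range (p - 1)).map fun a : ℕ => (genX j (-1 - ((a : ZMod p) + 1) * ε j), false)
  else [(genX j d, true)]

/-- The conjugate by `x_1 ^ ν` of `[a_1, b_1] ⋯ [a_g, b_g]`. -/
def commWord (ν : ZMod p) : List (KernelGen g (s + 2) p × Bool) :=
  (List.finRange g).flatMap fun i =>
    [(genA i ν, true), (genB i ν, true), (genA i ν, false), (genB i ν, false)]

/-- The part of the relator that comes from one of the `p` factors of
`(x_3 ⋯ x_t [a_1, b_1] ⋯ [a_g, b_g] x_1) ^ p`, where the commutators are conjugated by `x_1 ^ ν`. -/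
def blockWord (ν : ZMod p) : List (KernelGen g (s + 2) p × Bool) :=
  (List.finRange s).flatMap (fun j => slotWord ε j (ν - τ j)) ++ commWord ν

/-- The single relator, composed of one block for each residue `ν`; the last block has `ν = -1`. -/
def relatorWord : List (KernelGen g (s + 2) p × Bool) :=
  (List.range p).flatMap fun r : ℕ => blockWord ε τ (-1 - ((r : ZMod p) + 1) * e₁)

/-- The position of a letter in the relator: the number of its block, the number of its place in
the block, and its position there, ordered lexicographically. -/
def letterKey : KernelGen g (s + 2) p × Bool → ℕ ×ₗ ℕ ×ₗ ℕ
  | (.A i n, true) => toLex (progIndex e₁ (n : ℕ), toLex (s + i, 0))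
  | (.B i n, true) => toLex (progIndex e₁ (n : ℕ), toLex (s + i, 1))
  | (.A i n, false) => toLex (progIndex e₁ (n : ℕ), toLex (s + i, 2))
  | (.B i n, false) => toLex (progIndex e₁ (n : ℕ), toLex (s + i, 3))
  | (.X i h m, true) =>
    toLex (progIndex e₁ ((m : ℕ) + τ ⟨i - 2, by omega⟩), toLex (i - 2, 0))
  | (.X i h m, false) =>
    toLex (progIndex e₁ (-1 + τ ⟨i - 2, by omega⟩),
      toLex (i - 2, progIndex (ε ⟨i - 2, by omega⟩) (m : ℕ)))

theorem letterKey_genA_true (i : Fin g) (n : ZMod p) :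
    letterKey e₁ ε τ (genA i n, true) = toLex (progIndex e₁ n, toLex (s + i.val, 0)) := by
  simp [letterKey, genA]

theorem letterKey_genA_false (i : Fin g) (n : ZMod p) :
    letterKey e₁ ε τ (genA i n, false) = toLex (progIndex e₁ n, toLex (s + i.val, 2)) := by
  simp [letterKey, genA]

theorem letterKey_genB_true (i : Fin g) (n : ZMod p) :
    letterKey e₁ ε τ (genB i n, true) = toLex (progIndex e₁ n, toLex (s + i.val, 1)) := by
  simp [letterKey, genB]

theorem letterKey_genB_false (i : Fin g) (n : ZMod p) :
    letterKey e₁ ε τ (genB i n, false) = toLex (progIndex e₁ n, toLex (s + i.val, 3)) := by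
  simp [letterKey, genB]

theorem letterKey_genX_true (j : Fin s) {d : ZMod p} (hd : d ≠ -1) :
    letterKey (g := g) e₁ ε τ (genX j d, true) =
      toLex (progIndex e₁ (d + τ j), toLex (j.val, 0)) := by
  simp [letterKey, genX, Nat.mod_eq_of_lt (ZMod.val_lt_pred hd)]

theorem letterKey_genX_false (j : Fin s) {d : ZMod p} (hd : d ≠ -1) :
    letterKey (g := g) e₁ ε τ (genX j d, false) =
      toLex (progIndex e₁ (-1 + τ j), toLex (j.val, progIndex (ε j) d)) := by
  simp [letterKey, genX, Nat.mod_eq_of_lt (ZMod.val_lt_pred hd)]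

variable {e₁ ε τ}

theorem neg_one_sub_ne {a : ℕ} (ha : a < p - 1) {e : ZMod p} (he : e ≠ 0) :
    -1 - ((a : ZMod p) + 1) * e ≠ -1 := by
  intro h
  have h1 := progIndex_eq he (r := a) (by omega)
  rw [h, progIndex_neg_one] at h1
  omega

theorem key_of_mem_slotWord (hε : ∀ j, ε j ≠ 0) {j : Fin s} {d : ZMod p}
    {x : KernelGen g (s + 2) p × Bool} (hx : x ∈ slotWord ε j d) :
    ∃ a, letterKey e₁ ε τ x = toLex (progIndex e₁ (d + τ j), toLex (j.val, a)) := by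
  unfold slotWord at hx
  split_ifs at hx with h
  · obtain ⟨a, ha, rfl⟩ := List.mem_map.1 hx
    rw [letterKey_genX_false _ _ _ _ (neg_one_sub_ne (List.mem_range.1 ha) (hε j)), h]
    exact ⟨_, rfl⟩
  · rw [List.mem_singleton.1 hx, letterKey_genX_true _ _ _ _ h]
    exact ⟨_, rfl⟩

theorem pairwise_slotWord (hε : ∀ j, ε j ≠ 0) (j : Fin s) (d : ZMod p) :
    (slotWord (g := g) ε j d).Pairwise (letterKey e₁ ε τ · < letterKey e₁ ε τ ·) := by
  unfold slotWord
  split_ifs with h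
  · rw [List.pairwise_map]
    refine List.pairwise_lt_range.imp_of_mem fun {a b} ha hb hab => ?_
    have ha := List.mem_range.1 ha
    have hb := List.mem_range.1 hb
    rw [letterKey_genX_false _ _ _ _ (neg_one_sub_ne ha (hε j)),
      letterKey_genX_false _ _ _ _ (neg_one_sub_ne hb (hε j)), progIndex_eq (hε j) (by omega),
      progIndex_eq (hε j) (by omega)]
    simp [Prod.Lex.toLex_lt_toLex, hab]
  · exact List.pairwise_singleton _ _

theorem key_of_mem_commWord {ν : ZMod p} {x : KernelGen g (s + 2) p × Bool}
    (hx : x ∈ commWord ν) :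
    ∃ i a, letterKey e₁ ε τ x = toLex (progIndex e₁ ν, toLex (s + i, a)) := by
  simp only [commWord, List.mem_flatMap, List.mem_finRange, true_and, List.mem_cons,
    List.not_mem_nil, or_false] at hx
  obtain ⟨i, rfl | rfl | rfl | rfl⟩ := hx
  · exact ⟨_, _, letterKey_genA_true ..⟩
  · exact ⟨_, _, letterKey_genB_true ..⟩
  · exact ⟨_, _, letterKey_genA_false ..⟩
  · exact ⟨_, _, letterKey_genB_false ..⟩

theorem pairwise_commWord (ν : ZMod p) :
    (commWord (g := g) (s := s) ν).Pairwise (letterKey e₁ ε τ · < letterKey e₁ ε τ ·) := by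
  refine List.pairwise_flatMap.2 ⟨fun i _ => ?_, ?_⟩
  · simp [letterKey_genA_true, letterKey_genA_false, letterKey_genB_true, letterKey_genB_false,
      Prod.Lex.toLex_lt_toLex]
  · refine (List.pairwise_lt_finRange g).imp fun {i i'} h => ?_
    simp [letterKey_genA_true, letterKey_genA_false, letterKey_genB_true, letterKey_genB_false,
      Prod.Lex.toLex_lt_toLex, h]

theorem key_of_mem_blockWord (hε : ∀ j, ε j ≠ 0) {ν : ZMod p} {x : KernelGen g (s + 2) p × Bool}
    (hx : x ∈ blockWord ε τ ν) :
    ∃ a, letterKey e₁ ε τ x = toLex (progIndex e₁ ν, a) := by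
  rcases List.mem_append.1 hx with hx | hx
  · obtain ⟨j, _, hj⟩ := List.mem_flatMap.1 hx
    obtain ⟨a, ha⟩ := key_of_mem_slotWord (e₁ := e₁) (τ := τ) hε hj
    rw [sub_add_cancel] at ha
    exact ⟨_, ha⟩
  · obtain ⟨_, _, h⟩ := key_of_mem_commWord (e₁ := e₁) (ε := ε) (τ := τ) hx
    exact ⟨_, h⟩

theorem pairwise_blockWord (hε : ∀ j, ε j ≠ 0) (ν : ZMod p) :
    (blockWord (g := g) ε τ ν).Pairwise (letterKey e₁ ε τ · < letterKey e₁ ε τ ·) := by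
  refine List.pairwise_append.2 ⟨List.pairwise_flatMap.2 ⟨fun j _ => pairwise_slotWord hε _ _,
    (List.pairwise_lt_finRange s).imp fun {j j'} h x hx y hy => ?_⟩, pairwise_commWord _,
    fun x hx y hy => ?_⟩
  · obtain ⟨a, ha⟩ := key_of_mem_slotWord (e₁ := e₁) (τ := τ) hε hx
    obtain ⟨b, hb⟩ := key_of_mem_slotWord (e₁ := e₁) (τ := τ) hε hy
    rw [ha, hb, sub_add_cancel, sub_add_cancel]
    simp [Prod.Lex.toLex_lt_toLex, h]
  · obtain ⟨j, _, hj⟩ := List.mem_flatMap.1 hx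
    obtain ⟨a, ha⟩ := key_of_mem_slotWord (e₁ := e₁) (τ := τ) hε hj
    obtain ⟨i, b, hb⟩ := key_of_mem_commWord (e₁ := e₁) (ε := ε) (τ := τ) hy
    rw [ha, hb, sub_add_cancel]
    have := j.2
    simp only [Prod.Lex.toLex_lt_toLex, lt_irrefl, true_and, false_or]
    omega

theorem pairwise_relatorWord (he₁ : e₁ ≠ 0) (hε : ∀ j, ε j ≠ 0) :
    (relatorWord (g := g) e₁ ε τ).Pairwise (letterKey e₁ ε τ · < letterKey e₁ ε τ ·) := by
  refine List.pairwise_flatMap.2 ⟨fun r _ => pairwise_blockWord hε _,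
    List.pairwise_lt_range.imp_of_mem fun {r r'} hr hr' h x hx y hy => ?_⟩
  obtain ⟨a, ha⟩ := key_of_mem_blockWord (e₁ := e₁) hε hx
  obtain ⟨b, hb⟩ := key_of_mem_blockWord (e₁ := e₁) hε hy
  rw [ha, hb, progIndex_eq he₁ (List.mem_range.1 hr), progIndex_eq he₁ (List.mem_range.1 hr')]
  simp [Prod.Lex.toLex_lt_toLex, h]

theorem mem_relatorWord_of_mem_blockWord (he₁ : e₁ ≠ 0) {ν : ZMod p}
    {x : KernelGen g (s + 2) p × Bool} (hx : x ∈ blockWord ε τ ν) : x ∈ relatorWord e₁ ε τ :=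
  List.mem_flatMap.2 ⟨progIndex e₁ ν, List.mem_range.2 (progIndex_lt _ _), by
    rwa [progIndex_spec he₁]⟩

theorem mem_relatorWord_of_mem_slotWord (he₁ : e₁ ≠ 0) {j : Fin s} {d : ZMod p}
    {x : KernelGen g (s + 2) p × Bool} (hx : x ∈ slotWord ε j d) : x ∈ relatorWord e₁ ε τ := by
  refine mem_relatorWord_of_mem_blockWord he₁ (ν := d + τ j)
    (List.mem_append_left _ (List.mem_flatMap.2 ⟨j, List.mem_finRange j, ?_⟩))
  rwa [add_sub_cancel_right]

theorem mem_relatorWord (he₁ : e₁ ≠ 0) (hε : ∀ j, ε j ≠ 0) (x : KernelGen g (s + 2) p × Bool) :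
    x ∈ relatorWord e₁ ε τ := by
  obtain ⟨c, b⟩ := x
  rcases c.cases_zmod with ⟨i, n, rfl⟩ | ⟨i, n, rfl⟩ | ⟨j, d, hd, rfl⟩
  · refine mem_relatorWord_of_mem_blockWord he₁ (ν := n) (List.mem_append_right _
      (List.mem_flatMap.2 ⟨i, List.mem_finRange i, ?_⟩))
    cases b <;> simp
  · refine mem_relatorWord_of_mem_blockWord he₁ (ν := n) (List.mem_append_right _
      (List.mem_flatMap.2 ⟨i, List.mem_finRange i, ?_⟩))
    cases b <;> simp
  · cases b
    · refine mem_relatorWord_of_mem_slotWord he₁ (j := j) (d := -1) ?_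
      rw [slotWord, if_pos rfl, List.mem_map]
      refine ⟨progIndex (ε j) d, List.mem_range.2 ?_, by rw [progIndex_spec (hε j)]⟩
      have h1 := progIndex_lt (ε j) d
      have h2 : progIndex (ε j) d ≠ progIndex (ε j) (-1) :=
        fun h => hd (progIndex_injective (hε j) h)
      rw [progIndex_neg_one] at h2
      omega
    · refine mem_relatorWord_of_mem_slotWord he₁ (j := j) (d := d) ?_
      rw [slotWord, if_neg hd]
      exact List.mem_singleton_self _

/-! ### Linked pairs in the relator -/

theorem linkedForm_genA_genB (he₁ : e₁ ≠ 0) (hε : ∀ j, ε j ≠ 0) (i : Fin g) (n : ZMod p) :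
    LinkedForm (relatorWord e₁ ε τ) (genA i n) (genB i n) := by
  refine .of_key_lt (pairwise_relatorWord he₁ hε) (mem_relatorWord he₁ hε) ?_ ?_ ?_ <;>
  simp [letterKey_genA_true, letterKey_genA_false, letterKey_genB_true, letterKey_genB_false,
      Prod.Lex.toLex_lt_toLex]

/-- The letters of two families occupy alternate places. Hence the occurrences of a generator of
the first family enclose just one of the two places of the second family that lie in the same blocks
as these occurrences. The inverses of the second family are gathered at a single place, so one of
the two generators with these places is separated from its inverse. -/
theorem exists_linkedInRelation_of_ne (he₁ : e₁ ≠ 0) (hε : ∀ j, ε j ≠ 0) {j j' : Fin s}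
    (hj : j ≠ j') {d : ZMod p} (hd : d ≠ -1) :
    ∃ d' : ZMod p, d' ≠ -1 ∧
      LinkedInRelation (relatorWord (g := g) e₁ ε τ) (genX j d) (genX j' d') := by
  have hr : progIndex e₁ (d + τ j) ≠ progIndex e₁ (-1 + τ j) :=
    fun h => hd (add_right_cancel (progIndex_injective he₁ h))
  have hj : j.val ≠ j'.val := fun h => hj (Fin.ext h)
  have main : ∀ ν, (¬ ((progIndex e₁ (d + τ j) < progIndex e₁ ν ∨
        progIndex e₁ (d + τ j) = progIndex e₁ ν ∧ j.val < j'.val ↔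
      progIndex e₁ (-1 + τ j) < progIndex e₁ ν ∨
        progIndex e₁ (-1 + τ j) = progIndex e₁ ν ∧ j.val < j'.val) ↔
      (progIndex e₁ (d + τ j) < progIndex e₁ (-1 + τ j') ∨
        progIndex e₁ (d + τ j) = progIndex e₁ (-1 + τ j') ∧ j.val < j'.val ↔
      progIndex e₁ (-1 + τ j) < progIndex e₁ (-1 + τ j') ∨
        progIndex e₁ (-1 + τ j) = progIndex e₁ (-1 + τ j') ∧ j.val < j'.val))) →
      ∃ d' : ZMod p, d' ≠ -1 ∧
        LinkedInRelation (relatorWord (g := g) e₁ ε τ) (genX j d) (genX j' d') := by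
    intro ν h
    have hν : ν - τ j' ≠ -1 := by
      intro h'
      rw [sub_eq_iff_eq_add.1 h'] at h
      exact h Iff.rfl
    refine ⟨ν - τ j', hν, .of_separated (pairwise_relatorWord he₁ hε) (mem_relatorWord he₁ hε)
      (fun h => hj (by rw [(genX_injective hν hd h).1])) ?_⟩
    simpa only [letterKey_genX_true _ _ _ _ hd, letterKey_genX_true _ _ _ _ hν,
      letterKey_genX_false _ _ _ _ hd, letterKey_genX_false _ _ _ _ hν, sub_add_cancel,
      Prod.Lex.toLex_lt_toLex, hj, false_and, or_false] using h
  -- One of the two blocks that contain `s` or `s⁻¹` serves, by comparison of the block numbers.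
  by_contra hc
  have h1 := fun h => hc (main (d + τ j) h)
  have h2 := fun h => hc (main (-1 + τ j) h)
  rw [imp_false, not_not] at h1 h2
  generalize progIndex e₁ (d + τ j) = r at *
  generalize progIndex e₁ (-1 + τ j) = r₀ at *
  generalize progIndex e₁ (-1 + τ j') = r' at *
  rcases Nat.lt_or_gt_of_ne hj with hj | hj <;> rcases Nat.lt_or_gt_of_ne hr with hr | hr <;>
    simp only [hj, hj.not_gt, hr, hr.not_gt, hr.ne, hr.ne', lt_irrefl, and_true, and_false,
      or_false, or_true, true_iff, iff_true, false_iff, iff_false] at h1 h2 <;> grind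

/-- If the inverses of all families lie in the last block, then two generators of different families
whose positive occurrences lie in the same block are linked. -/
theorem linkedInWord_of_ne (he₁ : e₁ ≠ 0) (hε : ∀ j, ε j ≠ 0) {j j' : Fin s}
    (hj : j ≠ j') {d : ZMod p} (hd : d ≠ -1) (hτ : ∀ j, τ j = 0) :
    LinkedInWord (relatorWord (g := g) e₁ ε τ) (genX j d) (genX j' d) := by
  have hr : progIndex e₁ d < progIndex e₁ (-1) := by
    have h1 := progIndex_lt e₁ d
    have h2 : progIndex e₁ d ≠ progIndex e₁ (-1) := fun h => hd (progIndex_injective he₁ h)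
    have h3 := progIndex_neg_one e₁
    omega
  have aux : ∀ j j' : Fin s, j < j' →
      LinkedForm (relatorWord (g := g) e₁ ε τ) (genX j d) (genX j' d) := by
    intro j j' hj
    refine .of_key_lt (pairwise_relatorWord he₁ hε) (mem_relatorWord he₁ hε) ?_ ?_ ?_ <;>
    simp [letterKey_genX_true _ _ _ _ hd, letterKey_genX_false _ _ _ _ hd, hτ, hr, hj,
      Prod.Lex.toLex_lt_toLex]
  rcases lt_or_gt_of_ne hj with h | h
  · exact Or.inl (aux _ _ h)
  · exact Or.inr (aux _ _ h)

theorem progIndex_add_one {e d : ZMod p} (he : e ≠ 0) (hd : d ≠ -1) :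
    progIndex e d + 1 = (-(d + 1) * e⁻¹).val := by
  have h1 := progIndex_lt e d
  have h2 : progIndex e d ≠ progIndex e (-1) := fun h => hd (progIndex_injective he h)
  rw [progIndex_neg_one] at h2
  rw [← ZMod.val_cast_of_lt (show progIndex e d + 1 < p by omega), Nat.cast_add, progIndex,
    ZMod.natCast_zmod_val, Nat.cast_one, sub_add_cancel]

/-- The number of a block, counted cyclically from the block that contains the inverses. -/
theorem progIndex_add (e d τ : ZMod p) :
    progIndex e (d + τ) = (progIndex e (-1 + τ) + (-(d + 1) * e⁻¹).val) % p := by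
  rw [progIndex, progIndex, ← ZMod.val_add]
  congr 1
  ring

/-- Two generators of one family are linked if their inverses come in the same order as the
generators do, the latter counted cyclically from the place of the inverses. -/
theorem linked_of_same_order (he₁ : e₁ ≠ 0) (hε : ∀ j, ε j ≠ 0) {j : Fin s}
    {d d' : ZMod p} (hd : d ≠ -1) (hd' : d' ≠ -1) (h : progIndex (ε j) d < progIndex (ε j) d')
    (h' : progIndex e₁ d < progIndex e₁ d') :
    LinkedInRelation (relatorWord (g := g) e₁ ε τ) (genX j d) (genX j d') ∧
      ((∀ j, τ j = 0) → LinkedForm (relatorWord (g := g) e₁ ε τ) (genX j d) (genX j d')) := by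
  have hdd : d' ≠ d := by
    rintro rfl
    exact lt_irrefl _ h
  have h1 := progIndex_add_one he₁ hd
  have h2 := progIndex_add_one he₁ hd'
  constructor
  · refine .of_separated (pairwise_relatorWord he₁ hε) (mem_relatorWord he₁ hε)
      (fun h => hdd (genX_injective hd' hd h).2) ?_
    have h3 := progIndex_add e₁ d (τ j)
    have h4 := progIndex_add e₁ d' (τ j)
    have h5 := progIndex_lt e₁ (-1 + τ j)
    have h6 := ZMod.val_lt (-(d + 1) * e₁⁻¹)
    have h7 := ZMod.val_lt (-(d' + 1) * e₁⁻¹)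
    simp only [letterKey_genX_true _ _ _ _ hd, letterKey_genX_true _ _ _ _ hd',
      letterKey_genX_false _ _ _ _ hd, letterKey_genX_false _ _ _ _ hd',
      Prod.Lex.toLex_lt_toLex, lt_irrefl, false_or, true_and, and_false, or_false, h, or_true,
      not_lt_zero, and_true]
    rw [← h1] at h3 h6
    rw [← h2] at h4 h7
    have cases : ∀ r₀ δ : ℕ, r₀ < p → δ < p → (r₀ + δ < p ∧ (r₀ + δ) % p = r₀ + δ) ∨
        (p ≤ r₀ + δ ∧ (r₀ + δ) % p = r₀ + δ - p) := by
      intro r₀ δ h h'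
      rcases lt_or_ge (r₀ + δ) p with h'' | h''
      · exact Or.inl ⟨h'', Nat.mod_eq_of_lt h''⟩
      · exact Or.inr ⟨h'', by rw [Nat.mod_eq_sub_mod h'', Nat.mod_eq_of_lt (by omega)]⟩
    have c1 := cases _ _ h5 h6
    have c2 := cases _ _ h5 h7
    rw [← h3] at c1
    rw [← h4] at c2
    clear h1 h2 h3 h4 cases
    grind
  · intro hτ
    have h3 := progIndex_lt e₁ d'
    have h4 : progIndex e₁ d' ≠ progIndex e₁ (-1) := fun h => hd' (progIndex_injective he₁ h)
    have h5 := progIndex_neg_one e₁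
    have h6 : progIndex e₁ d' < progIndex e₁ (-1) := by omega
    refine .of_key_lt (pairwise_relatorWord he₁ hε) (mem_relatorWord he₁ hε) ?_ ?_ ?_ <;>
    simp [letterKey_genX_true _ _ _ _ hd, letterKey_genX_false _ _ _ _ hd,
      letterKey_genX_true _ _ _ _ hd', letterKey_genX_false _ _ _ _ hd', hτ, h, h', h6,
      Prod.Lex.toLex_lt_toLex]

/-- Within one family, the inverses occur in one place, and the other letters follow from there on,
cyclically, in the order obtained by multiplication by `ε j / e₁`. Two generators are linked if both
orders agree on them, and by `ZMod.eq_neg_one_of_val_lt_iff` this happens for every generator unless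
the order is reversed, that is, unless `ε j = -e₁`. -/
theorem exists_linked_same_family (he₁ : e₁ ≠ 0) (hε : ∀ j, ε j ≠ 0) {j : Fin s}
    (hj : ε j ≠ -e₁) {d : ZMod p} (hd : d ≠ -1) :
    ∃ d' : ZMod p, d' ≠ -1 ∧ d' ≠ d ∧
      LinkedInRelation (relatorWord (g := g) e₁ ε τ) (genX j d) (genX j d') ∧
      ((∀ j, τ j = 0) → LinkedInWord (relatorWord (g := g) e₁ ε τ) (genX j d) (genX j d')) := by
  by_contra! hc
  refine hj ?_
  have hεj := hε j
  have hc0 : ε j * e₁⁻¹ ≠ 0 := mul_ne_zero hεj (inv_ne_zero he₁)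
  have hd1 : d + 1 ≠ 0 := fun h => hd (eq_neg_of_add_eq_zero_left h)
  have hs0 : -(d + 1) * (ε j)⁻¹ ≠ 0 := mul_ne_zero (neg_ne_zero.2 hd1) (inv_ne_zero hεj)
  suffices h : ε j * e₁⁻¹ = -1 by
    rw [← div_eq_mul_inv, div_eq_iff he₁] at h
    rw [h, neg_one_mul]
  refine ZMod.eq_neg_one_of_val_lt_iff (s := -(d + 1) * (ε j)⁻¹) hc0 hs0 fun u hu hus => ?_
  obtain ⟨d', rfl⟩ : ∃ d', u = -(d' + 1) * (ε j)⁻¹ := ⟨-1 - u * ε j, by field_simp; ring⟩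
  have hd' : d' ≠ -1 := by
    rintro rfl
    simp at hu
  have hdd : d' ≠ d := by
    rintro rfl
    exact hus rfl
  have e1 : ∀ d : ZMod p, ε j * e₁⁻¹ * (-(d + 1) * (ε j)⁻¹) = -(d + 1) * e₁⁻¹ := by
    intro d
    field_simp
  rw [e1, e1, ← progIndex_add_one hεj hd, ← progIndex_add_one hεj hd', ← progIndex_add_one he₁ hd,
    ← progIndex_add_one he₁ hd']
  have hne : progIndex e₁ d' ≠ progIndex e₁ d := fun h => hdd (progIndex_injective he₁ h)
  have hne' : progIndex (ε j) d' ≠ progIndex (ε j) d := fun h => hdd (progIndex_injective hεj h)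
  have h1 : ¬ (progIndex (ε j) d < progIndex (ε j) d' ∧ progIndex e₁ d < progIndex e₁ d') := by
    rintro ⟨h, h'⟩
    obtain ⟨l, l'⟩ := linked_of_same_order (g := g) (τ := τ) he₁ hε hd hd' h h'
    obtain ⟨t, n⟩ := hc d' hd' hdd l
    exact n (Or.inl (l' t))
  have h2 : ¬ (progIndex (ε j) d' < progIndex (ε j) d ∧ progIndex e₁ d' < progIndex e₁ d) := by
    rintro ⟨h, h'⟩
    obtain ⟨l, l'⟩ := linked_of_same_order (g := g) (τ := τ) he₁ hε hd' hd h h'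
    obtain ⟨t, n⟩ := hc d' hd' hdd l.symm
    exact n (Or.inr (l' t))
  omega

/-- The hypothesis concerns a single family, which has to be linked within itself. -/
theorem exists_linked_relatorWord (he₁ : e₁ ≠ 0) (hε : ∀ j, ε j ≠ 0)
    (hs : ∀ j : Fin s, (∀ j', j' = j) → ε j ≠ -e₁) (c : KernelGen g (s + 2) p) :
    (∃ u, u ≠ c ∧ LinkedInRelation (relatorWord e₁ ε τ) c u) ∧
      ((∀ j, τ j = 0) → ∃ u, u ≠ c ∧ LinkedInWord (relatorWord e₁ ε τ) c u) := by
  rcases c.cases_zmod with ⟨i, n, rfl⟩ | ⟨i, n, rfl⟩ | ⟨j, d, hd, rfl⟩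
  · have h : LinkedInWord (relatorWord e₁ ε τ) (genA i n) (genB i n) :=
      Or.inl (linkedForm_genA_genB he₁ hε i n)
    have hne : genB i n ≠ genA (s := s) i n := by simp [genA, genB]
    exact ⟨⟨_, hne, _, .refl _, h⟩, fun _ => ⟨_, hne, h⟩⟩
  · have h : LinkedInWord (relatorWord e₁ ε τ) (genB i n) (genA i n) :=
      Or.inr (linkedForm_genA_genB he₁ hε i n)
    have hne : genA i n ≠ genB (s := s) i n := by simp [genA, genB]
    exact ⟨⟨_, hne, _, .refl _, h⟩, fun _ => ⟨_, hne, h⟩⟩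
  · by_cases h : ∀ j', j' = j
    · obtain ⟨d', hd', hdd, l, l'⟩ := exists_linked_same_family (g := g) (τ := τ) he₁ hε (hs j h) hd
      have hne : genX j d' ≠ genX (g := g) j d := fun h => hdd (genX_injective hd' hd h).2
      exact ⟨⟨_, hne, l⟩, fun hτ => ⟨_, hne, l' hτ⟩⟩
    · obtain ⟨j', hj⟩ := not_forall.1 h
      obtain ⟨d', hd', l⟩ := exists_linkedInRelation_of_ne (g := g) (τ := τ) he₁ hε (Ne.symm hj) hd
      exact ⟨⟨_, fun h => hj (genX_injective hd' hd h).1, l⟩, fun hτ =>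
        ⟨_, fun h => hj (genX_injective hd hd h).1,
          linkedInWord_of_ne he₁ hε (Ne.symm hj) hd hτ⟩⟩

end Relator

/-! ### Values of words -/

section WordValue

variable {α G : Type*} [Group G]

/-- The value of a word when the symbol `c` stands for `f c`. -/
def wordVal (f : α → G) (L : List (α × Bool)) : G := FreeGroup.lift f (FreeGroup.mk L)

variable (f : α → G)

theorem wordVal_nil : wordVal f [] = 1 := by simp [wordVal]

theorem wordVal_cons (x : α × Bool) (L : List (α × Bool)) :
    wordVal f (x :: L) = (bif x.2 then f x.1 else (f x.1)⁻¹) * wordVal f L := by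
  simp [wordVal]

theorem wordVal_append (L L' : List (α × Bool)) :
    wordVal f (L ++ L') = wordVal f L * wordVal f L' := by
  rw [wordVal, ← FreeGroup.mul_mk, map_mul, wordVal, wordVal]

theorem wordVal_flatMap {ι : Type*} (l : List ι) (w : ι → List (α × Bool)) :
    wordVal f (l.flatMap w) = (l.map fun i => wordVal f (w i)).prod := by
  induction l with
  | nil => simp [wordVal_nil]
  | cons i l ih => simp [wordVal_append, ih]

theorem wordVal_map_false {ι : Type*} (l : List ι) (c : ι → α) :
    wordVal f (l.map fun i => (c i, false)) = (l.map fun i => (f (c i))⁻¹).prod := by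
  induction l with
  | nil => simp [wordVal_nil]
  | cons i l ih => simp [wordVal_cons, ih]

theorem wordVal_mem_range (L : List (α × Bool)) : wordVal f L ∈ (FreeGroup.lift f).range :=
  ⟨_, rfl⟩

theorem Subgroup.HasPresentation.lift_eq_one {H : Subgroup G} {f : α → G}
    {rels : Set (FreeGroup α)} (h : H.HasPresentation f rels) {r : FreeGroup α} (hr : r ∈ rels) :
    FreeGroup.lift f r = 1 := by
  rw [← MonoidHom.mem_ker, h.2]
  exact Subgroup.subset_normalClosure hr

theorem Subgroup.HasPresentation.exists_hom {rels : Set (FreeGroup α)} {f : α → G}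
    (h : (⊤ : Subgroup G).HasPresentation f rels) {H : Type*} [Group H] (T : α → H)
    (hT : ∀ r ∈ rels, FreeGroup.lift T r = 1) : ∃ Φ : G →* H, ∀ c, Φ (f c) = T c := by
  have hsurj := MonoidHom.range_eq_top.1 h.1
  have hker : (FreeGroup.lift f).ker ≤ (FreeGroup.lift T).ker := by
    rw [h.2]
    exact Subgroup.normalClosure_le_normal fun r hr => hT r hr
  refine ⟨(FreeGroup.lift f).liftOfRightInverse _ (Function.rightInverse_surjInv hsurj)
    ⟨FreeGroup.lift T, hker⟩, fun c => ?_⟩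
  have := (FreeGroup.lift f).liftOfRightInverse_comp_apply _
    (Function.rightInverse_surjInv hsurj) ⟨FreeGroup.lift T, hker⟩ (FreeGroup.of c)
  simpa using this

end WordValue

/-! ### Products along the walk of an element through the cosets -/

section Cocycle

variable {p : ℕ} {G : Type*} [Group G]

/-- The product `S (n - k e) ⋯ S (n - 2 e) S (n - e)`. If `S m` is the Schreier element of `x` at
the coset `m`, and `e = φ x`, it is the Schreier element of `x ^ k` that ends at the coset `n`. -/
def walkProd (S : ZMod p → G) (e n : ZMod p) : ℕ → G
  | 0 => 1
  | k + 1 => S (n - ((k : ZMod p) + 1) * e) * walkProd S e n k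

theorem walkProd_succ (S : ZMod p → G) (e n : ZMod p) (k : ℕ) :
    walkProd S e n (k + 1) = S (n - ((k : ZMod p) + 1) * e) * walkProd S e n k := rfl

theorem inv_walkProd (S : ZMod p → G) (e n : ZMod p) (k : ℕ) :
    (walkProd S e n k)⁻¹ =
      ((List.range k).map fun r : ℕ => (S (n - ((r : ZMod p) + 1) * e))⁻¹).prod := by
  induction k with
  | zero => simp [walkProd]
  | succ k ih => simp [walkProd, List.range_succ, ih]

theorem walkProd_shift (S : ZMod p → G) (e c n : ZMod p) (k : ℕ) :
    walkProd (fun d => S (d + c)) e n k = walkProd S e (n + c) k := by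
  induction k with
  | zero => rfl
  | succ k ih => rw [walkProd, walkProd, ih, sub_add_eq_add_sub]

theorem walkProd_one (e n : ZMod p) (k : ℕ) :
    walkProd (fun _ => (1 : G)) e n k = 1 := by
  induction k with
  | zero => rfl
  | succ k ih => rw [walkProd, ih, one_mul]

theorem walkProd_conj (P : ZMod p → G) (x : G) (e n : ZMod p) (k : ℕ) :
    walkProd (fun m => P m * x * (P (m + e))⁻¹) e n k = P (n - k * e) * x ^ k * (P n)⁻¹ := by
  induction k with
  | zero => simp [walkProd]
  | succ k ih =>
    have : n - ((k : ZMod p) + 1) * e + e = n - k * e := by ring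
    rw [walkProd, ih, this]
    push_cast
    group

/-- The permutation by which a group element `x` acts on `ZMod p × G`, where `e` is the image of `x`
in `ZMod p`, and `S m` is the Schreier element of `x` that starts at the coset `m`. -/
def cocyclePerm (e : ZMod p) (S : ZMod p → G) : Equiv.Perm (ZMod p × G) where
  toFun z := (z.1 - e, S (z.1 - e) * z.2)
  invFun z := (z.1 + e, (S z.1)⁻¹ * z.2)
  left_inv z := by simp
  right_inv z := by simp

theorem cocyclePerm_apply (e : ZMod p) (S : ZMod p → G) (n : ZMod p) (γ : G) :
    cocyclePerm e S (n, γ) = (n - e, S (n - e) * γ) := rfl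

theorem cocyclePerm_inv_apply (e : ZMod p) (S : ZMod p → G) (n : ZMod p) (γ : G) :
    (cocyclePerm e S)⁻¹ (n, γ) = (n + e, (S n)⁻¹ * γ) := rfl

theorem cocyclePerm_pow_apply (e : ZMod p) (S : ZMod p → G) (k : ℕ) (n : ZMod p) (γ : G) :
    (cocyclePerm e S ^ k) (n, γ) = (n - k * e, walkProd S e n k * γ) := by
  induction k with
  | zero => simp [walkProd]
  | succ k ih =>
    have : n - k * e - e = n - ((k : ZMod p) + 1) * e := by ring
    rw [pow_succ', Equiv.Perm.mul_apply, ih, cocyclePerm_apply, this, walkProd, mul_assoc]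
    push_cast
    rfl

/-- The relation `x ^ p = 1` has to be checked at one coset only. -/
theorem cocyclePerm_pow_eq_one [Fact p.Prime] {e : ZMod p} (he : e ≠ 0) {S : ZMod p → G}
    {n₀ : ZMod p} (h : walkProd S e n₀ p = 1) : cocyclePerm e S ^ p = 1 := by
  ext1 ⟨n, γ⟩
  set k := ((n₀ - n) * e⁻¹).val with hk
  have hz : (n, γ) = (cocyclePerm e S ^ k) (n₀, (walkProd S e n₀ k)⁻¹ * γ) := by
    rw [cocyclePerm_pow_apply, mul_inv_cancel_left, hk, ZMod.natCast_zmod_val,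
      inv_mul_cancel_right₀ he, sub_sub_cancel]
  have hp : (cocyclePerm e S ^ p) (n₀, (walkProd S e n₀ k)⁻¹ * γ) =
      (n₀, (walkProd S e n₀ k)⁻¹ * γ) := by
    rw [cocyclePerm_pow_apply, h]
    simp
  rw [hz, ← Equiv.Perm.mul_apply, ← pow_add, add_comm, pow_add, Equiv.Perm.mul_apply, hp]
  rfl

/-- A product `x_1 ⋯ x_i` acts by the product of the Schreier elements along its path. -/
theorem prod_cocyclePerm_apply {t : ℕ} (e : Fin t → ZMod p) (S : Fin t → ZMod p → G)
    (i : Fin (t + 1)) (m : ZMod p) (γ : G) :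
    Fin.partialProd (fun l => cocyclePerm (e l) (S l)) i (m + Fin.partialSum e i, γ) =
      (m, Fin.partialProd (fun l => S l (m + Fin.partialSum e l.castSucc)) i * γ) := by
  induction i using Fin.induction generalizing γ with
  | zero => simp
  | succ i ih =>
    rw [Fin.partialProd_succ, Fin.partialProd_succ, Fin.partialSum_succ, Equiv.Perm.mul_apply,
      cocyclePerm_apply, ← add_assoc, add_sub_cancel_right, ih, mul_assoc]

/-- The same product, evaluated in the group in which the Schreier elements were formed. -/
theorem prod_walk_conj {t : ℕ} (P : ZMod p → G) (x : Fin t → G) (e : Fin t → ZMod p)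
    (i : Fin (t + 1)) (m : ZMod p) :
    Fin.partialProd (fun l => P (m + Fin.partialSum e l.castSucc) * x l *
      (P (m + Fin.partialSum e l.castSucc + e l))⁻¹) i =
      P m * Fin.partialProd x i * (P (m + Fin.partialSum e i))⁻¹ := by
  induction i using Fin.induction with
  | zero => simp
  | succ i ih =>
    rw [Fin.partialProd_succ, ih, Fin.partialProd_succ, Fin.partialSum_succ, ← add_assoc]
    group

theorem Fin.partialProd_last_eq {M : Type*} [Monoid M] {t : ℕ} (x : Fin t → M) :
    Fin.partialProd x (Fin.last t) = (List.ofFn x).prod := by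
  rw [Fin.partialProd, Fin.val_last, List.take_of_length_le (by simp)]

end Cocycle

/-! ### The transversal of powers -/

section ZModPow

variable {p : ℕ} [Fact p.Prime] {G : Type*} [Group G]

/-- The power of `x` with exponent in `ZMod p`, for an element with `x ^ p = 1`. -/
def zmodPow (x : G) (n : ZMod p) : G := x ^ n.val

variable {x : G}

theorem zmodPow_natCast (hx : x ^ p = 1) (k : ℕ) : zmodPow x (k : ZMod p) = x ^ k := by
  rw [zmodPow, ZMod.val_natCast, ← pow_eq_pow_mod k hx]

theorem zmodPow_add (hx : x ^ p = 1) (m n : ZMod p) :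
    zmodPow x (m + n) = zmodPow x m * zmodPow x n := by
  rw [zmodPow, ZMod.val_add, ← pow_eq_pow_mod _ hx, pow_add, zmodPow, zmodPow]

theorem zmodPow_one (hx : x ^ p = 1) : zmodPow x (1 : ZMod p) = x := by
  simpa using zmodPow_natCast hx 1

end ZModPow

/-! ### The Schreier elements as words -/

section Schreier

variable {g s p : ℕ} [Fact p.Prime] {G : Type*} [Group G]

/-- The exponents of `x_3, …, x_t` in `ZMod p`, given those of `x_1, …, x_t`. -/
def famExp (e : Fin (s + 2) → ZMod p) (j : Fin s) : ZMod p := e j.succ.succ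

/-- The coset `κ` at which the Schreier element `X_i` starts, relative to the coset of
`x_1 ⋯ x_{i-1}`. -/
def famShift (e κ : Fin (s + 2) → ZMod p) (j : Fin s) : ZMod p :=
  κ j.succ.succ - Fin.partialSum e j.succ.succ.castSucc

theorem wordVal_relatorWord (f : KernelGen g (s + 2) p → G) (e₁ : ZMod p) (ε τ : Fin s → ZMod p) :
    wordVal f (relatorWord e₁ ε τ) =
      (walkProd (fun n => (wordVal f (blockWord ε τ (n - 1)))⁻¹) e₁ 0 p)⁻¹ := by
  rw [inv_walkProd, relatorWord, wordVal_flatMap]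
  congr 1
  refine List.map_congr_left fun r _ => ?_
  rw [inv_inv]
  congr 2
  ring

theorem wordVal_slotWord_neg_one (f : KernelGen g (s + 2) p → G) (ε : Fin s → ZMod p) (j : Fin s)
    (S : ZMod p → G) (hε : ε j ≠ 0) (hS : ∀ d, d ≠ -1 → f (genX j d) = S d) :
    wordVal f (slotWord ε j (-1)) = (walkProd S (ε j) (-1) (p - 1))⁻¹ := by
  rw [inv_walkProd, slotWord, if_pos rfl, wordVal_map_false]
  congr 1
  refine List.map_congr_left fun r hr => ?_
  rw [hS _ (neg_one_sub_ne (List.mem_range.1 hr) hε)]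

theorem wordVal_slotWord_of_ne (f : KernelGen g (s + 2) p → G) (ε : Fin s → ZMod p) (j : Fin s)
    {d : ZMod p} (hd : d ≠ -1) : wordVal f (slotWord ε j d) = f (genX j d) := by
  rw [slotWord, if_neg hd, wordVal_cons, wordVal_nil, mul_one, cond_true]

theorem wordVal_commWord (f : KernelGen g (s + 2) p → G) (ν : ZMod p) :
    wordVal f (commWord ν) = ((List.finRange g).map fun i => f (genA i ν) * f (genB i ν) *
      (f (genA i ν))⁻¹ * (f (genB i ν))⁻¹).prod := by
  rw [commWord, wordVal_flatMap]
  simp [wordVal_cons, wordVal_nil, mul_assoc]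

/-- The Schreier elements of `x_1, …, x_t` at all cosets, as words in the generators of the kernel.
For `x_1` they are trivial, and for `x_2` they are obtained from the long relation. -/
def schreierVal (e κ : Fin (s + 2) → ZMod p) (f : KernelGen g (s + 2) p → G) :
    Fin (s + 2) → ZMod p → G :=
  Fin.cons (fun _ => 1) (Fin.cons
    (fun n => (wordVal f (blockWord (famExp e) (famShift e κ) (n - 1)))⁻¹)
    fun j n => wordVal f (slotWord (famExp e) j (n - κ j.succ.succ)))

variable (e κ : Fin (s + 2) → ZMod p) (f : KernelGen g (s + 2) p → G)

theorem schreierVal_zero (n : ZMod p) : schreierVal e κ f 0 n = 1 := rfl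

theorem schreierVal_one (n : ZMod p) : schreierVal e κ f 1 n =
    (wordVal f (blockWord (famExp e) (famShift e κ) (n - 1)))⁻¹ := rfl

theorem schreierVal_succ_succ (j : Fin s) (n : ZMod p) : schreierVal e κ f j.succ.succ n =
    wordVal f (slotWord (famExp e) j (n - κ j.succ.succ)) := rfl

/-- The long relation, read from the coset `ν` on, runs through the Schreier elements of `x_1` and
`x_2` and then through a block of the relator. -/
theorem prod_mul_commWord (S : Fin (s + 2) → ZMod p → G)
    (hS : ∀ j : Fin s, ∀ n, S j.succ.succ n = schreierVal e κ f j.succ.succ n) (he : e 0 = 1)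
    (ν : ZMod p) :
    (List.ofFn fun l => S l (ν + Fin.partialSum e l.castSucc)).prod * wordVal f (commWord ν) =
      S 0 ν * S 1 (ν + 1) * wordVal f (blockWord (famExp e) (famShift e κ) ν) := by
  have h1 : Fin.partialSum e (Fin.castSucc (Fin.succ (0 : Fin (s + 1)))) = 1 := by
    rw [← Fin.succ_castSucc, Fin.partialSum_succ]
    simp [he]
  rw [List.ofFn_succ, List.ofFn_succ, List.prod_cons, List.prod_cons, h1, blockWord, wordVal_append,
    wordVal_flatMap, List.ofFn_eq_map]
  simp only [hS, schreierVal_succ_succ, famShift, Fin.castSucc_zero, Fin.partialSum_zero, add_zero,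
    mul_assoc, Fin.succ_zero_eq_one, sub_sub_eq_add_sub]

variable {e κ f} {y : OrbifoldGen g (s + 2) → G}

theorem schreierVal_mem_range (l : Fin (s + 2)) (n : ZMod p) :
    schreierVal e κ f l n ∈ (FreeGroup.lift f).range := by
  refine Fin.cases ?_ (Fin.cases ?_ ?_) l
  · exact one_mem _
  · exact inv_mem (wordVal_mem_range _ _)
  · exact fun j => wordVal_mem_range _ _

/-- The images `y` of the generators satisfy the relations of the orbifold group, `e l` is the image
of `x_l` in `ZMod p`, scaled so that `x_1` has the image `1`, and `f` sends the symbols to the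
Schreier elements of the kernel, where those of the `x_i` start at the cosets `κ i`. -/
structure IsSchreierSystem (y : OrbifoldGen g (s + 2) → G) (e κ : Fin (s + 2) → ZMod p)
    (f : KernelGen g (s + 2) p → G) : Prop where
  pow_eq_one : ∀ l, y (.x l) ^ p = 1
  long_relation : (List.ofFn fun l => y (.x l)).prod * (List.ofFn fun i =>
    y (.a i) * y (.b i) * (y (.a i))⁻¹ * (y (.b i))⁻¹).prod = 1
  exp_zero : e 0 = 1
  exp_ne_zero : ∀ l, e l ≠ 0
  sum_exp : Fin.partialSum e (Fin.last _) = 0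
  val_A : ∀ i n, f (genA i n) = zmodPow (y (.x 0)) n * y (.a i) * (zmodPow (y (.x 0)) n)⁻¹
  val_B : ∀ i n, f (genB i n) = zmodPow (y (.x 0)) n * y (.b i) * (zmodPow (y (.x 0)) n)⁻¹
  val_X : ∀ j d, d ≠ -1 → f (genX j d) = zmodPow (y (.x 0)) (d + κ j.succ.succ) *
    y (.x j.succ.succ) * (zmodPow (y (.x 0)) (d + κ j.succ.succ + e j.succ.succ))⁻¹

namespace IsSchreierSystem

theorem schreierVal_succ_succ (h : IsSchreierSystem y e κ f) (j : Fin s) (n : ZMod p) :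
    schreierVal e κ f j.succ.succ n = zmodPow (y (.x 0)) n * y (.x j.succ.succ) *
      (zmodPow (y (.x 0)) (n + e j.succ.succ))⁻¹ := by
  rw [_root_.schreierVal_succ_succ]
  by_cases hd : n - κ j.succ.succ = -1
  · have hn : n = κ j.succ.succ - 1 := by rw [sub_eq_iff_eq_add.1 hd]; ring
    have hx : (y (.x j.succ.succ) ^ (p - 1))⁻¹ = y (.x j.succ.succ) := by
      rw [inv_eq_iff_mul_eq_one, ← pow_succ, Nat.sub_add_cancel (Fact.out : p.Prime).one_lt.le,
        h.pow_eq_one]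
    have e1 : -1 - -1 * famExp e j + κ j.succ.succ = n + e j.succ.succ := by
      rw [hn, famExp]
      ring
    have e2 : -1 + κ j.succ.succ = n := by rw [hn]; ring
    have hw := walkProd_conj (fun d => zmodPow (y (.x 0)) (d + κ j.succ.succ)) (y (.x j.succ.succ))
      (famExp e j) (-1) (p - 1)
    rw [hd, wordVal_slotWord_neg_one f (famExp e) j _ (h.exp_ne_zero _) (fun d hd => ?_), hw,
      ZMod.natCast_pred, mul_inv_rev, mul_inv_rev, inv_inv, hx, ← mul_assoc, e2, e1]
    rw [h.val_X j d hd, famExp, add_right_comm]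
  · rw [wordVal_slotWord_of_ne _ _ _ hd, h.val_X j _ hd, sub_add_cancel]

theorem wordVal_commWord (h : IsSchreierSystem y e κ f) (ν : ZMod p) :
    wordVal f (commWord ν) = zmodPow (y (.x 0)) ν *
    (List.ofFn fun i => y (.a i) * y (.b i) * (y (.a i))⁻¹ * (y (.b i))⁻¹).prod *
      (zmodPow (y (.x 0)) ν)⁻¹ := by
  rw [_root_.wordVal_commWord, ← MulAut.conj_apply, map_list_prod, List.ofFn_eq_map, List.map_map]
  congr 1
  refine List.map_congr_left fun i _ => ?_
  simp only [h.val_A, h.val_B, Function.comp_apply, map_mul, map_inv, MulAut.conj_apply]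

theorem schreierVal_one (h : IsSchreierSystem y e κ f) (n : ZMod p) :
    schreierVal e κ f 1 n =
      zmodPow (y (.x 0)) n * y (.x 1) * (zmodPow (y (.x 0)) (n + e 1))⁻¹ := by
  have hx := h.pow_eq_one 0
  have hw := prod_walk_conj (zmodPow (y (.x 0))) (fun l => y (.x l)) e (Fin.last _) (n - 1)
  rw [h.sum_exp, add_zero, Fin.partialProd_last_eq, Fin.partialProd_last_eq] at hw
  have hb := prod_mul_commWord e κ f
    (fun l m => zmodPow (y (.x 0)) m * y (.x l) * (zmodPow (y (.x 0)) (m + e l))⁻¹)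
    (fun j m => (h.schreierVal_succ_succ j m).symm) h.exp_zero (n - 1)
  have h0 : zmodPow (y (.x 0)) (n - 1) * y (.x 0) * (zmodPow (y (.x 0)) (n - 1 + e 0))⁻¹ = 1 := by
    rw [h.exp_zero, zmodPow_add hx, zmodPow_one hx, mul_inv_cancel]
  rw [hw, h.wordVal_commWord, h0, one_mul, sub_add_cancel] at hb
  rw [_root_.schreierVal_one, inv_eq_iff_mul_eq_one, mul_eq_one_iff_eq_inv,
    ← mul_eq_one_iff_eq_inv', ← hb]
  have hl := h.long_relation
  calc _ = zmodPow (y (.x 0)) (n - 1) * ((List.ofFn fun l => y (.x l)).prod * (List.ofFn fun i =>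
      y (.a i) * y (.b i) * (y (.a i))⁻¹ * (y (.b i))⁻¹).prod) *
      (zmodPow (y (.x 0)) (n - 1))⁻¹ := by group
    _ = 1 := by rw [hl]; group

/-- The words of `schreierVal` stand for the Schreier elements of all the `x_l` at all cosets, even
where these elements are not among the generators. -/
theorem schreierVal_eq (h : IsSchreierSystem y e κ f) (l : Fin (s + 2)) (n : ZMod p) :
    schreierVal e κ f l n =
      zmodPow (y (.x 0)) n * y (.x l) * (zmodPow (y (.x 0)) (n + e l))⁻¹ := by
  refine Fin.cases ?_ (Fin.cases ?_ ?_) l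
  · rw [schreierVal_zero, h.exp_zero, zmodPow_add (h.pow_eq_one 0), zmodPow_one (h.pow_eq_one 0),
      mul_inv_cancel]
  · exact h.schreierVal_one n
  · exact fun j => h.schreierVal_succ_succ j n

theorem wordVal_relatorWord (h : IsSchreierSystem y e κ f) :
    wordVal f (relatorWord (e 1) (famExp e) (famShift e κ)) = 1 := by
  have hw := walkProd_conj (zmodPow (y (.x 0))) (y (.x 1)) (e 1) 0 p
  simp only [← h.schreierVal_one, h.pow_eq_one, CharP.cast_eq_zero, zero_mul, sub_zero, mul_one,
    mul_inv_cancel] at hw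
  rw [_root_.wordVal_relatorWord, inv_eq_one]
  exact hw

/-- Schreier's lemma. -/
theorem mem_range_of_hom_eq_one (h : IsSchreierSystem y e κ f) {φ : G →* Multiplicative (ZMod p)}
    (hgen : (FreeGroup.lift y).range = ⊤) (hφa : ∀ i, φ (y (.a i)) = 1)
    (hφb : ∀ i, φ (y (.b i)) = 1) (hφx : ∀ l, φ (y (.x l)) = Multiplicative.ofAdd (e l)) {w : G}
    (hw : φ w = 1) : w ∈ (FreeGroup.lift f).range := by
  have main : ∀ w : G, ∀ n, zmodPow (y (.x 0)) n * w *
      (zmodPow (y (.x 0)) (n + (φ w).toAdd))⁻¹ ∈ (FreeGroup.lift f).range := by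
    intro w
    obtain ⟨v, rfl⟩ : w ∈ (FreeGroup.lift y).range := hgen ▸ Subgroup.mem_top w
    have hof : ∀ c n, zmodPow (y (.x 0)) n * y c *
        (zmodPow (y (.x 0)) (n + (φ (y c)).toAdd))⁻¹ ∈ (FreeGroup.lift f).range := by
      rintro (i | i | l) n
      · rw [hφa, toAdd_one, add_zero, ← h.val_A]
        exact ⟨FreeGroup.of _, FreeGroup.lift_apply_of⟩
      · rw [hφb, toAdd_one, add_zero, ← h.val_B]
        exact ⟨FreeGroup.of _, FreeGroup.lift_apply_of⟩
      · rw [hφx, toAdd_ofAdd, ← h.schreierVal_eq]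
        exact schreierVal_mem_range l n
    induction v using FreeGroup.induction_on with
    | C1 => simp
    | of c => simpa using hof c
    | inv_of c _ =>
      intro n
      have := inv_mem (hof c (n - (φ (y c)).toAdd))
      simpa [mul_assoc, sub_eq_add_neg] using this
    | mul v v' hv hv' =>
      intro n
      have := mul_mem (hv n) (hv' (n + (φ (FreeGroup.lift y v)).toAdd))
      rw [map_mul, map_mul, toAdd_mul, ← add_assoc]
      convert this using 1
      group
  simpa [hw, zmodPow] using main w 0

end IsSchreierSystem

end Schreier

/-! ### The action on the cosets with coefficients in the presented group -/

section Action

variable {g s p : ℕ} [Fact p.Prime] {Γ : Type*} [Group Γ] {e κ : Fin (s + 2) → ZMod p}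
  {f : KernelGen g (s + 2) p → Γ}

/-- The relations `x_l ^ p = 1`, read from a suitable coset on. -/
theorem walkProd_schreierVal (he : ∀ l, e l ≠ 0)
    (hR : wordVal f (relatorWord (e 1) (famExp e) (famShift e κ)) = 1) (l : Fin (s + 2)) :
    ∃ n₀, walkProd (schreierVal e κ f l) (e l) n₀ p = 1 := by
  refine Fin.cases ?_ (Fin.cases ?_ fun j => ?_) l
  · exact ⟨0, walkProd_one _ _ _⟩
  · rw [wordVal_relatorWord, inv_eq_one] at hR
    exact ⟨0, hR⟩
  · refine ⟨-1 + κ j.succ.succ, ?_⟩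
    have hp := Nat.sub_add_cancel (Fact.out : p.Prime).one_lt.le
    have hw := wordVal_slotWord_neg_one f (famExp e) j
      (fun d => schreierVal e κ f j.succ.succ (d + κ j.succ.succ)) (he _) fun d hd => by
        rw [schreierVal_succ_succ, add_sub_cancel_right, wordVal_slotWord_of_ne _ _ _ hd]
    rw [walkProd_shift] at hw
    -- The first of the `p` factors is the Schreier element at the coset `κ - 1`, which is defined
    -- as the inverse of the product of the others.
    have := walkProd_succ (schreierVal e κ f j.succ.succ) (e j.succ.succ)
      (-1 + κ j.succ.succ) (p - 1)
    rw [hp, ZMod.natCast_pred, neg_add_cancel, zero_mul, sub_zero, schreierVal_succ_succ,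
      add_sub_cancel_right, hw] at this
    exact this.trans (inv_mul_cancel _)

/-- The permutations of `ZMod p × Γ` that correspond to the generators of the orbifold group. -/
def orbifoldPerm (e κ : Fin (s + 2) → ZMod p) (f : KernelGen g (s + 2) p → Γ) :
    OrbifoldGen g (s + 2) → Equiv.Perm (ZMod p × Γ)
  | .a i => cocyclePerm 0 fun n => f (genA i n)
  | .b i => cocyclePerm 0 fun n => f (genB i n)
  | .x l => cocyclePerm (e l) (schreierVal e κ f l)

theorem prod_orbifoldPerm_comm (m : ZMod p) (γ : Γ) :
    (List.ofFn fun i : Fin g => orbifoldPerm e κ f (.a i) * orbifoldPerm e κ f (.b i) *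
      (orbifoldPerm e κ f (.a i))⁻¹ * (orbifoldPerm e κ f (.b i))⁻¹).prod (m, γ) =
      (m, wordVal f (commWord m) * γ) := by
  rw [wordVal_commWord, List.ofFn_eq_map]
  induction List.finRange g with
  | nil => simp
  | cons i l ih =>
    rw [List.map_cons, List.prod_cons, Equiv.Perm.mul_apply, ih]
    simp only [orbifoldPerm, Equiv.Perm.mul_apply, cocyclePerm_apply, cocyclePerm_inv_apply,
      add_zero, sub_zero, List.map_cons, List.prod_cons, mul_assoc]

/-- The permutations satisfy the relations of the orbifold group. This is where the single relator
is used: it amounts to the relation `x_2 ^ p = 1`, as the Schreier elements of `x_2` are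
defined by means of the long relation. -/
theorem lift_orbifoldPerm_eq_one (he₀ : e 0 = 1) (he : ∀ l, e l ≠ 0)
    (hsum : Fin.partialSum e (Fin.last _) = 0)
    (hR : wordVal f (relatorWord (e 1) (famExp e) (famShift e κ)) = 1) :
    ∀ r ∈ orbifoldRels g (s + 2) p, FreeGroup.lift (orbifoldPerm e κ f) r = 1 := by
  rintro r (rfl | ⟨l, rfl⟩)
  · ext1 ⟨m, γ⟩
    have hx := prod_cocyclePerm_apply e (schreierVal e κ f) (Fin.last _) m
      (wordVal f (commWord m) * γ)
    rw [hsum, add_zero, Fin.partialProd_last_eq, Fin.partialProd_last_eq, ← mul_assoc,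
      prod_mul_commWord e κ f _ (fun _ _ => rfl) he₀, schreierVal_zero, schreierVal_one, one_mul,
      add_sub_cancel_right, inv_mul_cancel, one_mul] at hx
    simp only [map_mul, map_list_prod, List.map_ofFn, Function.comp_def, map_inv,
      FreeGroup.lift_apply_of]
    rw [Equiv.Perm.mul_apply, prod_orbifoldPerm_comm]
    exact hx
  · obtain ⟨n₀, h⟩ := walkProd_schreierVal he hR l
    rw [map_pow, FreeGroup.lift_apply_of]
    exact cocyclePerm_pow_eq_one (he l) h

/-- `x_1` moves the cosets only. -/
theorem hom_zmodPow_apply {G : Type*} [Group G] {y : OrbifoldGen g (s + 2) → G} (he₀ : e 0 = 1)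
    {Φ : G →* Equiv.Perm (ZMod p × Γ)} (hΦ : ∀ c, Φ (y c) = orbifoldPerm e κ f c) (n m : ZMod p)
    (γ : Γ) : Φ (zmodPow (y (.x 0)) n) (m, γ) = (m - n, γ) := by
  have hS : schreierVal e κ f 0 = fun _ => 1 := rfl
  rw [zmodPow, map_pow, hΦ, orbifoldPerm, cocyclePerm_pow_apply, he₀, hS, walkProd_one, mul_one,
    ZMod.natCast_zmod_val, one_mul]

theorem hom_zmodPow_inv_apply {G : Type*} [Group G] {y : OrbifoldGen g (s + 2) → G} (he₀ : e 0 = 1)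
    {Φ : G →* Equiv.Perm (ZMod p × Γ)} (hΦ : ∀ c, Φ (y c) = orbifoldPerm e κ f c) (n m : ZMod p)
    (γ : Γ) : Φ (zmodPow (y (.x 0)) n)⁻¹ (m, γ) = (m + n, γ) := by
  rw [map_inv, Equiv.Perm.inv_eq_iff_eq, hom_zmodPow_apply he₀ hΦ, add_sub_cancel_right]

/-- The action recovers from an element of the kernel its expression by the generators. -/
theorem hom_lift_apply {G : Type*} [Group G] {y : OrbifoldGen g (s + 2) → G}
    {f₀ : KernelGen g (s + 2) p → G} (h : IsSchreierSystem y e κ f₀)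
    {Φ : G →* Equiv.Perm (ZMod p × Γ)} (hΦ : ∀ c, Φ (y c) = orbifoldPerm e κ f c)
    (w : FreeGroup (KernelGen g (s + 2) p)) (γ : Γ) :
    Φ (FreeGroup.lift f₀ w) (0, γ) = (0, FreeGroup.lift f w * γ) := by
  have hof : ∀ c γ, Φ (f₀ c) (0, γ) = (0, f c * γ) := by
    intro c γ
    rcases c.cases_zmod with ⟨i, n, rfl⟩ | ⟨i, n, rfl⟩ | ⟨j, d, hd, rfl⟩
    · rw [h.val_A, map_mul, map_mul, Equiv.Perm.mul_apply, hom_zmodPow_inv_apply h.exp_zero hΦ,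
        Equiv.Perm.mul_apply, hΦ, orbifoldPerm, cocyclePerm_apply, hom_zmodPow_apply h.exp_zero hΦ]
      simp
    · rw [h.val_B, map_mul, map_mul, Equiv.Perm.mul_apply, hom_zmodPow_inv_apply h.exp_zero hΦ,
        Equiv.Perm.mul_apply, hΦ, orbifoldPerm, cocyclePerm_apply, hom_zmodPow_apply h.exp_zero hΦ]
      simp
    · rw [h.val_X j d hd, map_mul, map_mul, Equiv.Perm.mul_apply,
        hom_zmodPow_inv_apply h.exp_zero hΦ, Equiv.Perm.mul_apply, hΦ, orbifoldPerm,
        cocyclePerm_apply, hom_zmodPow_apply h.exp_zero hΦ, zero_add, add_sub_cancel_right,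
        sub_self, schreierVal_succ_succ, add_sub_cancel_right, wordVal_slotWord_of_ne _ _ _ hd]
  induction w using FreeGroup.induction_on generalizing γ with
  | C1 => simp
  | of c => simpa using hof c γ
  | inv_of c _ =>
    rw [map_inv, map_inv, map_inv, Equiv.Perm.inv_eq_iff_eq, FreeGroup.lift_apply_of,
      FreeGroup.lift_apply_of, hof, mul_inv_cancel_left]
  | mul v v' hv hv' =>
    rw [map_mul, map_mul, map_mul, Equiv.Perm.mul_apply, hv', hv, mul_assoc]

/-- A word with the value `1` in the group acts trivially, and by `hom_lift_apply` its class modulo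
the relator is trivial then. -/
theorem IsSchreierSystem.hasPresentation {G : Type*} [Group G] {y : OrbifoldGen g (s + 2) → G}
    {f₀ : KernelGen g (s + 2) p → G} (h : IsSchreierSystem y e κ f₀)
    (hy : (⊤ : Subgroup G).HasPresentation y (orbifoldRels g (s + 2) p))
    {φ : G →* Multiplicative (ZMod p)} (hφa : ∀ i, φ (y (.a i)) = 1)
    (hφb : ∀ i, φ (y (.b i)) = 1) (hφx : ∀ l, φ (y (.x l)) = Multiplicative.ofAdd (e l)) :
    φ.ker.HasPresentation f₀
      {FreeGroup.mk (relatorWord (e 1) (famExp e) (famShift e κ))} := by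
  constructor
  · refine le_antisymm ?_ fun w hw =>
      h.mem_range_of_hom_eq_one hy.1 hφa hφb hφx (MonoidHom.mem_ker.1 hw)
    rw [MonoidHom.range_eq_map, Subgroup.map_le_iff_le_comap]
    intro w _
    rw [Subgroup.mem_comap, MonoidHom.mem_ker]
    have : φ.comp (FreeGroup.lift f₀) = 1 := by
      ext c
      have hP : ∀ n, φ (zmodPow (y (.x 0)) n) = Multiplicative.ofAdd n := by
        intro n
        rw [zmodPow, map_pow, hφx, h.exp_zero, ← ofAdd_nsmul, nsmul_one, ZMod.natCast_zmod_val]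
      rcases c.cases_zmod with ⟨i, n, rfl⟩ | ⟨i, n, rfl⟩ | ⟨j, d, hd, rfl⟩
      · simp [h.val_A, hφa]
      · simp [h.val_B, hφb]
      · simp only [MonoidHom.comp_apply, FreeGroup.lift_apply_of, h.val_X j d hd, map_mul, map_inv,
          hP, hφx, ofAdd_add, mul_inv_cancel, MonoidHom.one_apply]
    exact DFunLike.congr_fun this w
  · apply le_antisymm
    · intro w hw
      set N := Subgroup.normalClosure
        {FreeGroup.mk (relatorWord (g := g) (e 1) (famExp e) (famShift e κ))} with hN
      let f : KernelGen g (s + 2) p → FreeGroup (KernelGen g (s + 2) p) ⧸ N :=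
        fun c => (FreeGroup.of c : FreeGroup (KernelGen g (s + 2) p))
      have hf : FreeGroup.lift f = QuotientGroup.mk' N := by
        ext c
        simp [f]
      have hR : wordVal f (relatorWord (e 1) (famExp e) (famShift e κ)) = 1 := by
        rw [wordVal, hf, QuotientGroup.mk'_apply, QuotientGroup.eq_one_iff]
        exact Subgroup.subset_normalClosure rfl
      obtain ⟨Φ, hΦ⟩ := hy.exists_hom (orbifoldPerm e κ f)
        (lift_orbifoldPerm_eq_one h.exp_zero h.exp_ne_zero h.sum_exp hR)
      have := hom_lift_apply h hΦ w 1
      rw [MonoidHom.mem_ker.1 hw, map_one, hf, mul_one, QuotientGroup.mk'_apply] at this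
      exact (QuotientGroup.eq_one_iff w).1 (congrArg Prod.snd this).symm
    · refine Subgroup.normalClosure_le_normal ?_
      rintro _ rfl
      exact h.wordVal_relatorWord

end Action

/-! ### The generators of the kernel -/

section Kernel

variable {g t p : ℕ} {G : Type*} [Group G] {y : OrbifoldGen g t → G}

theorem orbifold_long_relation (hy : (⊤ : Subgroup G).HasPresentation y (orbifoldRels g t p)) :
    (List.ofFn fun l => y (.x l)).prod * (List.ofFn fun i =>
      y (.a i) * y (.b i) * (y (.a i))⁻¹ * (y (.b i))⁻¹).prod = 1 := by
  have := hy.lift_eq_one (Or.inl rfl)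
  simpa only [map_mul, map_list_prod, List.map_ofFn, Function.comp_def, map_inv,
    FreeGroup.lift_apply_of] using this

theorem orbifold_pow_eq_one (hy : (⊤ : Subgroup G).HasPresentation y (orbifoldRels g t p))
    (l : Fin t) : y (.x l) ^ p = 1 := by
  have := hy.lift_eq_one (Or.inr ⟨l, rfl⟩)
  simpa using this

theorem toAdd_hom_partialProd {φ : G →* Multiplicative (ZMod p)} {u : ZMod p} {e : Fin t → ZMod p}
    (he : ∀ l, (φ (y (.x l))).toAdd = e l * u) (i : Fin (t + 1)) :
    (φ (Fin.partialProd (fun l => y (.x l)) i)).toAdd = Fin.partialSum e i * u := by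
  induction i using Fin.induction with
  | zero => simp
  | succ i ih => rw [Fin.partialProd_succ, Fin.partialSum_succ, map_mul, toAdd_mul, ih, he, add_mul]

theorem partialSum_last_eq_zero (hy : (⊤ : Subgroup G).HasPresentation y (orbifoldRels g t p))
    [Fact p.Prime] {φ : G →* Multiplicative (ZMod p)} {u : ZMod p} (hu : u ≠ 0)
    {e : Fin t → ZMod p} (he : ∀ l, (φ (y (.x l))).toAdd = e l * u) :
    Fin.partialSum e (Fin.last t) = 0 := by
  have h1 := toAdd_hom_partialProd he (Fin.last t)
  have h2 := congrArg φ (orbifold_long_relation hy)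
  have h3 : φ (List.ofFn fun i =>
      y (.a i) * y (.b i) * (y (.a i))⁻¹ * (y (.b i))⁻¹).prod = 1 := by
    rw [map_list_prod, List.map_ofFn]
    refine List.prod_eq_one fun z hz => ?_
    obtain ⟨i, rfl⟩ := List.mem_ofFn.1 hz
    simp only [Function.comp_apply, map_mul, map_inv]
    rw [mul_right_comm, mul_inv_cancel_right, mul_inv_cancel]
  rw [map_mul, h3, mul_one, map_one] at h2
  rw [Fin.partialProd_last_eq, h2, toAdd_one] at h1
  exact (mul_eq_zero.1 h1.symm).resolve_right hu

end Kernel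

/-! ### The presentation with a linked relator -/

theorem isSchreierSystem_kernelElt {g s p : ℕ} [Fact p.Prime] {G : Type*} [Group G]
    {y : OrbifoldGen g (s + 2) → G} (ht : 0 < s + 2)
    (hy : (⊤ : Subgroup G).HasPresentation y (orbifoldRels g (s + 2) p))
    {φ : G →* Multiplicative (ZMod p)} (k : Fin (s + 2) → ℕ) {u : ZMod p} (hu : u ≠ 0)
    {e : Fin (s + 2) → ZMod p} (he : ∀ l, (φ (y (.x l))).toAdd = e l * u) (he₀ : e 0 = 1)
    (hne : ∀ l, e l ≠ 0) :
    IsSchreierSystem y e (fun l => (k l : ZMod p)) (kernelElt ht y φ k) := by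
  have hx := orbifold_pow_eq_one hy 0
  have hu' : (φ (y (.x 0))).toAdd = u := by rw [he, he₀, one_mul]
  refine ⟨orbifold_pow_eq_one hy, orbifold_long_relation hy, he₀, hne,
    partialSum_last_eq_zero hy hu he, fun i n => ?_, fun i n => ?_, fun j d hd => ?_⟩
  · change (MulAut.conj (y (.x 0)) ^ n.val) (y (.a i)) = _
    rw [← map_pow, MulAut.conj_apply, zmodPow]
  · change (MulAut.conj (y (.x 0)) ^ n.val) (y (.b i)) = _
    rw [← map_pow, MulAut.conj_apply, zmodPow]
  · have hrep : schreierRep φ (y (.x 0)) (y (.x 0) ^ k j.succ.succ * y (.x j.succ.succ)) =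
        zmodPow (y (.x 0)) ((k j.succ.succ : ZMod p) + e j.succ.succ) := by
      rw [schreierRep, zmodPow, map_mul, map_pow, toAdd_mul, toAdd_pow, he j.succ.succ, hu',
        nsmul_eq_mul, ← add_mul, mul_inv_cancel_right₀ hu]
    change (MulAut.conj (y (.x 0)) ^ (d.val % (p - 1))) (schreierElt φ (y (.x 0))
      (y (.x 0) ^ k j.succ.succ) (y (.x j.succ.succ))) = _
    have hd' : y (.x 0) ^ d.val = zmodPow (y (.x 0)) d := rfl
    rw [Nat.mod_eq_of_lt (ZMod.val_lt_pred hd), ← map_pow, MulAut.conj_apply, schreierElt, hrep,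
      hd']
    simp only [zmodPow_add hx, zmodPow_natCast hx]
    group

theorem mainTheorem1 {g₀ t p : ℕ} (hp : p.Prime) (ht : 0 < t)
    -- `F₀` is given by the presentation, with generators `a_i`, `b_i`, `x_j`
    {F₀ : Type*} [Group F₀] (y : OrbifoldGen g₀ t → F₀)
    (hF₀ : (⊤ : Subgroup F₀).HasPresentation y (orbifoldRels g₀ t p))
    (φ : F₀ →* Multiplicative (ZMod p))
    (hφa : ∀ i, φ (y (.a i)) = 1) (hφb : ∀ i, φ (y (.b i)) = 1) (hφx : ∀ j, φ (y (.x j)) ≠ 1)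
    -- the Schreier representatives `x_1 ^ k_i` used for the `X_i`
    (k : Fin t → ℕ) :
    ∃ R : List (KernelGen g₀ t p × Bool),
      φ.ker.HasPresentation (kernelElt ht y φ k) {FreeGroup.mk R} ∧
      (∀ s, OccursOnceEach s R) ∧ EvenlyWorded R ∧
      (∀ s, ∃ u, u ≠ s ∧ LinkedInRelation R s u) ∧
      -- linked without a cyclic permutation, if `X_i` starts at the coset of `x_1 ⋯ x_{i-1}`
      ((∀ i : Fin t, 2 ≤ i.val → y (.x ⟨0, ht⟩) ^ k i =
          schreierRep φ (y (.x ⟨0, ht⟩)) ((List.ofFn fun j => y (.x j)).take i.val).prod) →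
        ∀ s, ∃ u, u ≠ s ∧ LinkedInWord R s u) := by
  have : Fact p.Prime := ⟨hp⟩
  set u : ZMod p := (φ (y (.x ⟨0, ht⟩))).toAdd with hu
  have hu0 : u ≠ 0 := fun h => hφx ⟨0, ht⟩ (toAdd_eq_zero.1 h)
  set e : Fin t → ZMod p := fun l => (φ (y (.x l))).toAdd * u⁻¹ with he_def
  have he : ∀ l, (φ (y (.x l))).toAdd = e l * u := fun l => (inv_mul_cancel_right₀ hu0 _).symm
  have he₀ : e ⟨0, ht⟩ = 1 := mul_inv_cancel₀ hu0
  have hne : ∀ l, e l ≠ 0 := fun l =>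
    mul_ne_zero (fun h => hφx l (toAdd_eq_zero.1 h)) (inv_ne_zero hu0)
  have hsum := partialSum_last_eq_zero hF₀ hu0 he
  clear_value e u
  -- For `t = 1`, the long relation would give `φ x_1 = 0`.
  obtain ⟨s, rfl⟩ : ∃ s, t = s + 2 := by
    refine Nat.exists_eq_add_of_le' ?_
    by_contra hlt
    obtain rfl : t = 1 := by omega
    have := Fin.partialSum_succ e 0
    simp only [Fin.castSucc_zero, Fin.partialSum_zero, zero_add] at this
    exact hne 0 (this.symm.trans hsum)
  have hsys := isSchreierSystem_kernelElt ht hF₀ k hu0 he he₀ hne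
  have hε : ∀ j, famExp e j ≠ 0 := fun j => hne _
  -- For `t = 3`, the long relation says `1 + e_2 + e_3 = 0`, so `e_3 ≠ - e_2`.
  have hs : ∀ j : Fin s, (∀ j', j' = j) → famExp e j ≠ -e 1 := by
    intro j hj h
    obtain rfl : s = 1 := by
      have h1 := hj ⟨0, j.pos⟩
      have h2 := hj ⟨s - 1, by have := j.pos; omega⟩
      have h3 := congrArg Fin.val (h1.trans h2.symm)
      have := j.pos
      simp at h3
      omega
    obtain rfl : j = 0 := Subsingleton.elim _ _
    have h3 : Fin.partialSum e (Fin.last 3) = e 0 + e 1 + e 2 := by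
      have h1 := Fin.partialSum_succ e 0
      have h2 := Fin.partialSum_succ e 1
      have h3 := Fin.partialSum_succ e 2
      simp only [Fin.castSucc_zero, Fin.partialSum_zero, zero_add] at h1
      exact h3.trans (by rw [← h1]; exact congrArg (· + e 2) h2)
    have h4 : e 2 = -e 1 := h
    have h5 : e 0 = 1 := he₀
    rw [hsum, h4, h5] at h3
    simp at h3
  have hlink := exists_linked_relatorWord (g := g₀) (hne 1) hε
    (τ := famShift e fun l => (k l : ZMod p)) hs
  have hnd : (relatorWord (g := g₀) (e 1) (famExp e) (famShift e fun l => (k l : ZMod p))).Nodup :=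
    (pairwise_relatorWord (hne 1) hε).imp fun h h' => by simp [h'] at h
  have hmem := mem_relatorWord (g := g₀) (τ := famShift e fun l => (k l : ZMod p)) (hne 1) hε
  refine ⟨relatorWord (e 1) (famExp e) (famShift e fun l => (k l : ZMod p)), ?_,
    .of_nodup hnd hmem, fun c => by simp only [hmem], fun c => (hlink c).1,
    fun hk c => (hlink c).2 fun j => ?_⟩
  · -- Division by `φ x_1` changes `φ` into a homomorphism with `φ x_1 = 1` and the same kernel.
    set ψ := (AddMonoidHom.toMultiplicative (AddMonoidHom.mulRight u⁻¹)).comp φ with hψ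
    have hψ' : ∀ w, (ψ w).toAdd = (φ w).toAdd * u⁻¹ := fun w => rfl
    have hker : ψ.ker = φ.ker := by
      ext w
      rw [MonoidHom.mem_ker, MonoidHom.mem_ker, ← toAdd_eq_zero, hψ', mul_eq_zero,
        or_iff_left (inv_ne_zero hu0), toAdd_eq_zero]
    rw [← hker]
    refine hsys.hasPresentation hF₀ (fun i => ?_) (fun i => ?_) fun l => ?_
    · rw [hψ, MonoidHom.comp_apply, hφa, map_one]
    · rw [hψ, MonoidHom.comp_apply, hφb, map_one]
    · refine Multiplicative.toAdd.injective ?_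
      rw [hψ', he, mul_inv_cancel_right₀ hu0, toAdd_ofAdd]
  · have h1 := congrArg (fun w => (φ w).toAdd) (hk j.succ.succ (by simp))
    have h2 := toAdd_hom_partialProd he j.succ.succ.castSucc
    simp only [Fin.partialProd, Fin.val_castSucc] at h2
    simp only [schreierRep, map_pow, toAdd_pow, h2, he ⟨0, ht⟩, he₀, one_mul, nsmul_eq_mul,
      mul_inv_cancel_right₀ hu0, ZMod.natCast_zmod_val] at h1
    exact sub_eq_zero.2 (mul_right_cancel₀ hu0 h1)
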